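/- Let $X=(X_0,X_1,\dots)$ be a time-homogeneous Markov chain with transition kernel $Q$ on a general state space $\mathsf X$, and let $P_\nu$ (and $P_x$, if $\nu=\delta_x$) be its law on the canonical sequence space when $X_0\sim\nu$. Assume that the chain is $\psi$-irreducible, aperiodic and positive Harris recurrent, that $Q$ is reversible with respect to a probability measure $\pi$, and that it is geometrically ergodic: there are a real $\rho<1$ and a function $B:\mathsf X\to[0,\infty)$ with $\|Q^n(x,\cdot)-\pi\|_{\mathrm{TV}}\le B(x)\rho^n$ for all $x\in\mathsf X$ and all $n\ge 0$. Let $g:\mathsf X\to\mathbb R$ be measurable with $\int g^2\,d\pi<\infty$, and let $\gamma(k)=\operatorname{Cov}_{P_\pi}(g(X_0),g(X_{|k|}))$, $k\in\mathbb Z$, be its autocovariance sequence. A *representing measure* of a sequence $m:\mathbb Z\to\mathbb R$ is a (positive) Radon measure $\mu$ with $\operatorname{Supp}(\mu)\subseteq[-1,1]$ and $m(k)=\int\alpha^{|k|}\,\mu(d\alpha)$ for all $k\in\mathbb Z$. For $\delta>0$ let $\mathscr M_\infty(\delta)$ be the set of the sequences that have a representing measure supported in $[-1+\delta,1-\delta]$.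 For $m\in\ell_2(\mathbb Z,\mathbb R)$ let $\hat m(\omega)=\sum_{k}m(k)e^{-ik\omega}$ (sum in $L^2$), and for a weight $\phi$ put $\|m\|_\phi^2=\frac1{2\pi}\int_{[-\pi,\pi]}|\hat m(\omega)|^2\phi(\omega)^{-2}\,d\omega$. The *weighted moment LSE* is $$\Pi^{\phi}(r;\delta)=\operatorname*{arg\,min}_{f\in\mathscr M_\infty(\delta)\cap\ell_2(\mathbb Z,\mathbb R)}\|r-f\|_\phi^2 .$$ For each $M$ let $r_M$ be a random sequence on $\mathbb Z$ (an initial autocovariance estimator, a function of the path of the chain) such that * for every $x\in\mathsf X$ and $k\in\mathbb Z$, $r_M(k)\to\gamma(k)$ as $M\to\infty$, $P_x$-almost surely; * $r_M(k)=0$ for all $k\ge n(M)$, for some finite $n(M)$; * $r_M(-k)=r_M(k)$ and $|r_M(k)|\le r_M(0)$ for all $k$. For each $M$ let $\phi_M:\mathbb R\to\mathbb R$ be a (possibly random) weight function, again a function of the path, that is even, $2\pi$-periodic, twice continuously differentiable, and bounded between two positive (possibly random) constants; and suppose that there are deterministic constants $0<c_\phi,c_\phi'<\infty$ such that, for every $x\in\mathsf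 X$, $P_x$-almost surely, $$\liminf_{M\to\infty}\inf_{\omega\in[-\pi,\pi]}\phi_M(\omega)\ge c_\phi,\qquad \limsup_{M\to\infty}\max\{\|\phi_M\|_\infty,\|\phi_M'\|_\infty,\|\phi_M''\|_\infty\}\le c_\phi'.$$ Let finally $\delta>0$ be such that $\operatorname{Supp}(\mu_\gamma)\subseteq[-1+\delta,1-\delta]$, where $\mu_\gamma$ is the representing measure of $\gamma$. Then $\gamma$ has exactly one representing measure $\mu_\gamma$; for every $M$ the minimizer $\Pi^{\phi_M}(r_M;\delta)$ exists and is unique, and it has exactly one representing measure $\hat\mu_\delta^{\phi_M}$; and for every initial condition $x\in\mathsf X$, $$P_x\bigl(\hat\mu_\delta^{\phi_M}\to\mu_\gamma\ \text{vaguely, as } M\to\infty\bigr)=1 .$$ -/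

import Mathlib

open MeasureTheory ProbabilityTheory Filter Topology Set
open scoped ENNReal NNReal

namespace MomentLSE

noncomputable section

/-! ### Markov chains on a general state space -/

section Chain

variable {X : Type*} [MeasurableSpace X]

/-- The transition from the history `(X₀, …, Xₙ)` to `Xₙ₊₁`, which only looks at `Xₙ`. -/
def historyKernel (Q : Kernel X X) (n : ℕ) : Kernel ((i : Finset.Iic n) → X) X :=
  Q.comap (fun h => h ⟨n, Finset.mem_Iic.2 le_rfl⟩) (measurable_pi_apply _)

instance (Q : Kernel X X) [IsMarkovKernel Q] (n : ℕ) : IsMarkovKernel (historyKernel Q n) := by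
  unfold historyKernel
  infer_instance

/-- The law `P_ν`, on the canonical sequence space, of the Markov chain with transition kernel `Q`
and initial distribution `ν`. -/
def chainLaw (Q : Kernel X X) [IsMarkovKernel Q] (ν : Measure X) : Measure (ℕ → X) :=
  Kernel.trajMeasure (X := fun _ => X) ν (historyKernel Q)

/-- The law `P_x` of the chain started at the point `x`. -/
def chainLawFrom (Q : Kernel X X) [IsMarkovKernel Q] (x : X) : Measure (ℕ → X) :=
  chainLaw Q (Measure.dirac x)

/-- `ψ` is a maximal irreducibility measure of `Q`: it is a nontrivial irreducibility measure
which dominates every other irreducibility measure. The chain is `ψ`-irreducible if such a `ψ`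
exists. -/
structure IsMaximalIrreducibilityMeasure (Q : Kernel X X) (ψ : Measure X) : Prop where
  sigmaFinite : SigmaFinite ψ
  ne_zero : ψ ≠ 0
  irreducible : Q.IsIrreducible ψ
  maximal : ∀ φ : Measure X, SigmaFinite φ → Q.IsIrreducible φ → φ ≪ ψ

/-- The sets `D i`, `i ∈ ℤ/d`, form a `d`-cycle: they are disjoint, the chain moves from `D i` to
`D (i + 1)` with probability one, and they cover the space up to a `ψ`-null set. -/
structure IsCycle (Q : Kernel X X) (ψ : Measure X) (d : ℕ) (D : ZMod d → Set X) : Prop where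
  measurableSet : ∀ i, MeasurableSet (D i)
  disjoint : Pairwise fun i j => Disjoint (D i) (D j)
  step : ∀ i, ∀ x ∈ D i, Q x (D (i + 1)) = 1
  null : ψ (⋃ i, D i)ᶜ = 0

/-- The largest `d` for which there is a `d`-cycle is `d = 1`. -/
def IsAperiodic (Q : Kernel X X) (ψ : Measure X) : Prop :=
  ∀ d : ℕ, 2 ≤ d → ¬ ∃ D : ZMod d → Set X, IsCycle Q ψ d D

/-- Every set of positive `ψ`-measure is visited infinitely often, almost surely, from each of its
points. -/
def IsHarrisRecurrent (Q : Kernel X X) [IsMarkovKernel Q] (ψ : Measure X) : Prop :=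
  ∀ A : Set X, MeasurableSet A → 0 < ψ A →
    ∀ x ∈ A, ∀ᵐ p ∂(chainLawFrom Q x), ∃ᶠ n in atTop, p n ∈ A

/-- Harris ergodicity: the chain is `ψ`-irreducible, aperiodic and positive Harris recurrent,
where positivity means that there is an invariant probability measure. -/
def IsHarrisErgodic (Q : Kernel X X) [IsMarkovKernel Q] : Prop :=
  ∃ ψ : Measure X, IsMaximalIrreducibilityMeasure Q ψ ∧ IsAperiodic Q ψ ∧
    IsHarrisRecurrent Q ψ ∧ ∃ π : Measure X, IsProbabilityMeasure π ∧ Q.Invariant π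

/-- The total variation norm of the difference of two probability measures, with the convention
`sup_A |μ A - ν A|`. -/
def tvDist (μ ν : Measure X) : ℝ :=
  ⨆ A : {A : Set X // MeasurableSet A}, |μ.real A - ν.real A|

/-- Geometric ergodicity. (Another normalization of the total variation norm only changes `B` by
a constant factor.) -/
def IsGeometricallyErgodic (Q : Kernel X X) (π : Measure X) : Prop :=
  ∃ ρ : ℝ, ρ < 1 ∧ ∃ B : X → ℝ, (∀ x, 0 ≤ B x) ∧
    ∀ (x : X) (n : ℕ), tvDist ((Q ^ n) x) π ≤ B x * ρ ^ n

/-- The autocovariance sequence `γ(k) = Cov_π(g(X₀), g(X_{|k|}))`. -/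
def autocov (Q : Kernel X X) [IsMarkovKernel Q] (π : Measure X) (g : X → ℝ) (k : ℤ) : ℝ :=
  covariance (fun p : ℕ → X => g (p 0)) (fun p : ℕ → X => g (p k.natAbs)) (chainLaw Q π)

end Chain

/-! ### Moment sequences -/

/-- `μ` is a representing measure of the sequence `m`: a Radon measure supported in `[-1, 1]` with
`m(k) = ∫ α^|k| μ(dα)` for every integer `k`. -/
structure IsRepresentingMeasure (μ : Measure ℝ) (m : ℤ → ℝ) : Prop where
  locallyFinite : IsLocallyFiniteMeasure μ
  support_subset : μ.support ⊆ Icc (-1) 1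
  eq_integral : ∀ k : ℤ, m k = ∫ α, α ^ k.natAbs ∂μ

/-- The set of `C`-moment sequences. -/
def momentSpace (C : Set ℝ) : Set (ℤ → ℝ) :=
  {m | ∃ μ : Measure ℝ, IsRepresentingMeasure μ m ∧ μ.support ⊆ C}

/-- `m ∈ ℓ₂(ℤ, ℝ)`. -/
def IsSquareSummable (m : ℤ → ℝ) : Prop :=
  Summable fun k => m k ^ 2

/-! ### The weighted norm and the weighted moment least squares estimator -/

instance : Fact (0 < 2 * Real.pi) := ⟨Real.two_pi_pos⟩

/-- The Fourier transform `∑ₖ m(k) e^{-ikω}` of a square summable sequence; the sum converges in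
`L²` of the circle `ℝ / 2πℤ` with its normalized measure `(2π)⁻¹ dω`. -/
def fourierTransform (m : ℤ → ℝ) :
    Lp ℂ 2 (AddCircle.haarAddCircle (T := 2 * Real.pi)) :=
  ∑' k : ℤ, (m k : ℂ) • fourierLp 2 (-k)

/-- The squared weighted norm
`‖m‖_φ² = (2π)⁻¹ ∫_{[-π,π]} |m̂(ω)|² / φ(ω)² dω`. -/
def weightedNormSq (φ : ℝ → ℝ) (m : ℤ → ℝ) : ℝ :=
  (2 * Real.pi)⁻¹ * ∫ ω in Icc (-Real.pi) Real.pi,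
    ‖fourierTransform m (ω : AddCircle (2 * Real.pi))‖ ^ 2 / φ ω ^ 2

/-- `f` is a weighted moment least squares estimator for the input `r`, the weight `φ` and the set
`C`: a minimizer of `‖r - f‖_φ²` over the square summable `C`-moment sequences. -/
structure IsWeightedMomentLSE (φ : ℝ → ℝ) (r : ℤ → ℝ) (C : Set ℝ) (f : ℤ → ℝ) : Prop where
  mem : f ∈ momentSpace C
  squareSummable : IsSquareSummable f
  le : ∀ h ∈ momentSpace C, IsSquareSummable h → weightedNormSq φ (r - f) ≤ weightedNormSq φ (r - h)

/-! ### Conditions on the input sequence and on the weights -/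

section Conditions

variable {X : Type*} [MeasurableSpace X]

/-- Conditions on an initial autocovariance estimator `r M`, a function of the path of the chain:
almost sure elementwise convergence to `γ`, finite support, evenness, and a peak at `0`. -/
structure IsInitialEstimator (Q : Kernel X X) [IsMarkovKernel Q] (γ : ℤ → ℝ)
    (r : ℕ → (ℕ → X) → ℤ → ℝ) : Prop where
  tendsto : ∀ (x : X) (k : ℤ),
    ∀ᵐ p ∂(chainLawFrom Q x), Tendsto (fun M => r M p k) atTop (𝓝 (γ k))
  finite_support : ∀ M p, ∃ n : ℕ, ∀ k : ℤ, (n : ℤ) ≤ k → r M p k = 0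
  even : ∀ M p k, r M p (-k) = r M p k
  peak : ∀ M p k, |r M p k| ≤ r M p 0

/-- A real, even, `2π`-periodic weight of class `C²` bounded between two positive constants. -/
structure IsWeight (φ : ℝ → ℝ) : Prop where
  periodic : Function.Periodic φ (2 * Real.pi)
  even : ∀ ω, φ (-ω) = φ ω
  contDiff : ContDiff ℝ 2 φ
  bounded : ∃ c₀ c₁ : ℝ, 0 < c₀ ∧ ∀ ω, c₀ ≤ φ ω ∧ φ ω ≤ c₁

/-- The supremum norm. -/
def supNorm (f : ℝ → ℝ) : ℝ≥0∞ := ⨆ ω : ℝ, ‖f ω‖ₑ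

/-- Asymptotic bounds on the (random) weights, with deterministic constants: almost surely,
`liminf inf φ_M ≥ c > 0` and `limsup max (‖φ_M‖_∞, ‖φ_M'‖_∞, ‖φ_M''‖_∞) ≤ c' < ∞`. -/
def HasAsymptoticBounds (Q : Kernel X X) [IsMarkovKernel Q] (φ : ℕ → (ℕ → X) → ℝ → ℝ) : Prop :=
  ∃ c c' : ℝ≥0, 0 < c ∧ 0 < c' ∧ ∀ x : X, ∀ᵐ p ∂(chainLawFrom Q x),
    (c : ℝ≥0∞) ≤ liminf (fun M => ⨅ ω ∈ Icc (-Real.pi) Real.pi, ENNReal.ofReal (φ M p ω)) atTop ∧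
    limsup (fun M => max (supNorm (φ M p))
      (max (supNorm (deriv (φ M p))) (supNorm (deriv (deriv (φ M p)))))) atTop ≤ (c' : ℝ≥0∞)

end Conditions

/-- Vague convergence of measures on the line, tested against continuous functions with compact
support. -/
def VaguelyTendsto (μ : ℕ → Measure ℝ) (μ₀ : Measure ℝ) : Prop :=
  ∀ f : ℝ → ℝ, Continuous f → HasCompactSupport f →
    Tendsto (fun M => ∫ α, f α ∂(μ M)) atTop (𝓝 (∫ α, f α ∂μ₀))

end

end MomentLSE

/-! The argument is a projection estimate made pathwise; probability enters through the shape of the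
autocovariance and through the almost sure limits.

Reversibility makes the transition operator a self-adjoint contraction on `L²(π)`, so the
autocovariances are moments of a measure on `[-1, 1]` (`exists_representingMeasure_autocov`). By the
Riesz–Haviland criterion (`exists_measure_of_momentFunctional_nonneg`) the moment sequences of a
compact set are cut out by closed linear conditions, each on finitely many coordinates. Hence they
form a closed convex cone, compact once the mass `m 0` is bounded, and the quadratic objective has a
unique minimizer on it.

For consistency, let `f` be the minimizer for the input `r`. Optimality gives `‖f - γ‖² ≤ ⟨r - γ, f
- γ⟩` in the weighted norm. The error `r - γ` need not be small in that norm, since `r` converges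
only coordinatewise. But `f - γ` decays geometrically thanks to the gap `δ`, and the Fourier
coefficients of the `C²` function `φ⁻²` decay quadratically, so the pairing is bounded by the weak
norm `∑ |r k - γ k| / (1 + k²)` times `f 0 + γ 0` (`abs_weightedInner_le`, `sq_estimator_sub_le`).
The peak at `0` gives domination, so the weak norm tends to zero. The resulting inequality `(f 0 - γ
0)² ≤ ε (f 0 + γ 0)` first bounds `f 0`, and then every coordinate converges (`tendsto_estimator`).
By Weierstrass approximation, convergence of moments on `[-1, 1]` is vague convergence of the
representing measures. -/

namespace MomentLSE

/-! ### The Riesz–Haviland criterion on a compact set. -/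

open Polynomial in
/-- The linear functional on polynomials sending `X ^ k` to `m k`. -/
noncomputable def momentFunctional (m : ℕ → ℝ) : ℝ[X] →ₗ[ℝ] ℝ :=
  Polynomial.lsum fun k => LinearMap.toSpanSingleton ℝ ℝ (m k)

open Polynomial in
lemma momentFunctional_apply (m : ℕ → ℝ) (p : ℝ[X]) :
    momentFunctional m p = ∑ k ∈ p.support, p.coeff k * m k := by
  simp [momentFunctional, Polynomial.lsum_apply, Polynomial.sum_def]

open Polynomial in
lemma momentFunctional_X_pow (m : ℕ → ℝ) (k : ℕ) :
    momentFunctional m (X ^ k) = m k := by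
  simp [momentFunctional, Polynomial.lsum_apply, ← Polynomial.monomial_one_right_eq_X_pow]

open Polynomial in
lemma momentFunctional_eq_integral {m : ℕ → ℝ} {μ : Measure ℝ}
    (hint : ∀ k : ℕ, Integrable (fun x : ℝ => x ^ k) μ) (h : ∀ k, m k = ∫ x, x ^ k ∂μ) (p : ℝ[X]) :
    momentFunctional m p = ∫ x, p.eval x ∂μ := by
  rw [momentFunctional_apply]
  simp_rw [Polynomial.eval_eq_sum, Polynomial.sum_def]
  rw [integral_finsetSum _ fun k _ => (hint k).const_mul _]
  simp [integral_const_mul, h]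

/-- A linear functional on polynomials which is nonnegative on the polynomials that are nonnegative
on a compact set is integration against a finite measure carried by that set. -/
theorem exists_measure_of_momentFunctional_nonneg {C : Set ℝ} (hC : IsCompact C) (m : ℕ → ℝ)
    (h : ∀ p : Polynomial ℝ, (∀ x ∈ C, 0 ≤ p.eval x) → 0 ≤ momentFunctional m p) :
    ∃ μ : Measure ℝ, IsFiniteMeasure μ ∧ μ Cᶜ = 0 ∧ ∀ k, m k = ∫ x, x ^ k ∂μ := by
  have : CompactSpace C := isCompact_iff_compactSpace.1 hC
  -- The extension takes place on the product, not on `C(C, ℝ)`: a polynomial is not determined by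
  -- its restriction when `C` is finite, and the cone `p + u ≥ 0` identifies `(p, 0)` with `(0,
  -- p|C)` only through positivity.
  let s : PointedCone ℝ (Polynomial ℝ × C(C, ℝ)) :=
    { carrier := {y | ∀ x : C, 0 ≤ y.1.eval (x : ℝ) + y.2 x}
      add_mem' := by
        intro a b ha hb x
        have := add_nonneg (ha x) (hb x)
        simp only [Prod.fst_add, Prod.snd_add, Polynomial.eval_add, ContinuousMap.add_apply]
        linarith
      zero_mem' := by intro x; simp
      smul_mem' := by
        intro c a ha x
        have := mul_nonneg c.2 (ha x)
        have h1 : (c • a).1 = (c : ℝ) • a.1 := rfl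
        have h2 : (c • a).2 = (c : ℝ) • a.2 := rfl
        rw [h1, h2]
        simp only [Polynomial.eval_smul, ContinuousMap.smul_apply, smul_eq_mul]
        linarith }
  have hs : ∀ y, y ∈ s ↔ ∀ x : C, 0 ≤ y.1.eval (x : ℝ) + y.2 x := fun y => Iff.rfl
  let f : (Polynomial ℝ × C(C, ℝ)) →ₗ.[ℝ] ℝ :=
    (momentFunctional m ∘ₗ LinearMap.fst ℝ _ _).toPMap
      (LinearMap.range (LinearMap.inl ℝ (Polynomial ℝ) C(C, ℝ)))
  obtain ⟨G, hG, hGs⟩ := riesz_extension s f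
    (by
      rintro ⟨_, ⟨p, rfl⟩⟩ hp
      refine h p fun x hx => ?_
      simpa using hp ⟨x, hx⟩)
    (by
      rintro ⟨q, u⟩
      let v : C(C, ℝ) := Polynomial.toContinuousMapOn q C + u
      -- Domination hypothesis: by compactness of `C`, adding a large enough constant polynomial
      -- brings any pair into the cone.
      refine ⟨⟨(Polynomial.C ‖v‖, 0), ⟨Polynomial.C ‖v‖, rfl⟩⟩, fun x => ?_⟩
      have := (abs_le.1 (v.norm_coe_le_norm x)).1
      have hv : v x = q.eval (x : ℝ) + u x := rfl
      simp only [Prod.fst_add, Prod.snd_add, Polynomial.eval_add, Polynomial.eval_C,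
        zero_add]
      linarith)
  have hGp : ∀ p : Polynomial ℝ, G (p, 0) = momentFunctional m p := fun p =>
    hG ⟨(p, 0), ⟨p, rfl⟩⟩
  let Λ : CompactlySupportedContinuousMap C ℝ →ₚ[ℝ] ℝ := PositiveLinearMap.mk₀
    { toFun := fun u => G (0, u.toContinuousMap)
      map_add' := by
        intro u v
        rw [← map_add]
        congr 1
        ext <;> simp
      map_smul' := by
        intro c u
        rw [← map_smul]
        congr 1
        ext <;> simp }
    (fun u hu => hGs _ fun x => by simpa using hu x)
  let ν := RealRMK.rieszMeasure Λ
  have : IsFiniteMeasure ν := ⟨isCompact_univ.measure_lt_top⟩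
  have hcm : MeasurableSet C := hC.measurableSet
  refine ⟨ν.map Subtype.val, inferInstance, ?_, fun k => ?_⟩
  · rw [Measure.map_apply measurable_subtype_coe hcm.compl]
    simp
  · rw [integral_map measurable_subtype_coe.aemeasurable (by fun_prop)]
    let u : CompactlySupportedContinuousMap C ℝ :=
      { toFun := fun x => (x : ℝ) ^ k
        continuous_toFun := by fun_prop
        hasCompactSupport' := HasCompactSupport.of_compactSpace _ }
    have hu : ∫ x : C, (x : ℝ) ^ k ∂ν = G (0, u.toContinuousMap) :=
      RealRMK.integral_rieszMeasure Λ u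
    rw [hu, ← momentFunctional_X_pow m k, ← hGp]
    -- Both this pair and its negative lie in the cone, so `G` takes the same value on `X ^ k` and
    -- on its restriction to `C`.
    have h1 := hGs (Polynomial.X ^ k, -u.toContinuousMap) fun x => by simp [u]
    have h2 := hGs (-Polynomial.X ^ k, u.toContinuousMap) fun x => by simp [u]
    have e1 : ((Polynomial.X ^ k, -u.toContinuousMap) : Polynomial ℝ × C(C, ℝ)) =
      (Polynomial.X ^ k, 0) - (0, u.toContinuousMap) := by simp
    have e2 : ((-Polynomial.X ^ k, u.toContinuousMap) : Polynomial ℝ × C(C, ℝ)) =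
      (0, u.toContinuousMap) - (Polynomial.X ^ k, 0) := by simp
    rw [e1, map_sub] at h1
    rw [e2, map_sub] at h2
    linarith

/-! ### Representing measures: determinacy and convergence. -/

namespace IsRepresentingMeasure

variable {μ : Measure ℝ} {m : ℤ → ℝ}

lemma measure_compl_Icc (h : IsRepresentingMeasure μ m) : μ (Icc (-1) 1)ᶜ = 0 :=
  measure_mono_null (compl_subset_compl.2 h.support_subset) Measure.measure_compl_support

lemma isFiniteMeasure (h : IsRepresentingMeasure μ m) : IsFiniteMeasure μ := by
  have := h.locallyFinite
  refine ⟨?_⟩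
  have : (univ : Set ℝ) = Icc (-1) 1 ∪ (Icc (-1) 1)ᶜ := by simp
  rw [this]
  refine (measure_union_le _ _).trans_lt ?_
  rw [h.measure_compl_Icc, add_zero]
  exact isCompact_Icc.measure_lt_top

lemma ae_mem_Icc (h : IsRepresentingMeasure μ m) : ∀ᵐ x ∂μ, x ∈ Icc (-1 : ℝ) 1 :=
  h.measure_compl_Icc

lemma integrable (h : IsRepresentingMeasure μ m) {f : ℝ → ℝ} (hf : Continuous f) :
    Integrable f μ := by
  have := h.isFiniteMeasure
  obtain ⟨K, hK⟩ := (isCompact_Icc (a := (-1 : ℝ)) (b := 1)).exists_bound_of_continuousOn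
    hf.continuousOn
  exact Integrable.of_bound hf.aestronglyMeasurable K
    (h.ae_mem_Icc.mono fun x hx => hK x hx)

lemma even (h : IsRepresentingMeasure μ m) (k : ℤ) : m (-k) = m k := by
  rw [h.eq_integral, h.eq_integral, Int.natAbs_neg]

lemma apply_zero (h : IsRepresentingMeasure μ m) : m 0 = μ.real univ := by
  simp [h.eq_integral]

lemma momentFunctional_eq (h : IsRepresentingMeasure μ m) (p : Polynomial ℝ) :
    momentFunctional (fun k => m k) p = ∫ x, p.eval x ∂μ :=
  momentFunctional_eq_integral (fun k => h.integrable (by fun_prop))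
    (fun k => by simp [h.eq_integral]) p

/-- Convergence of moments implies vague convergence. -/
theorem tendsto_integral {ν : ℕ → Measure ℝ} {a : ℕ → ℤ → ℝ}
    (hν : ∀ n, IsRepresentingMeasure (ν n) (a n)) (h : IsRepresentingMeasure μ m)
    (ha : ∀ k, Tendsto (fun n => a n k) atTop (𝓝 (m k))) {f : ℝ → ℝ} (hf : Continuous f) :
    Tendsto (fun n => ∫ x, f x ∂(ν n)) atTop (𝓝 (∫ x, f x ∂μ)) := by
  -- Replacing `f` by a uniformly close polynomial costs at most `ε` times the total mass, which is
  -- the zeroth moment.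
  have happrox : ∀ {η : Measure ℝ} {b : ℤ → ℝ} (_ : IsRepresentingMeasure η b) {p : Polynomial ℝ}
      {ε : ℝ} (_ : ∀ x ∈ Icc (-1 : ℝ) 1, |p.eval x - f x| < ε),
      |momentFunctional (fun k => b k) p - ∫ x, f x ∂η| ≤ ε * b 0 := by
    intro η b hη p ε hp
    have := hη.isFiniteMeasure
    rw [hη.momentFunctional_eq, ← integral_sub (hη.integrable (by fun_prop)) (hη.integrable hf),
      hη.apply_zero]
    exact norm_integral_le_of_norm_le_const (f := fun x => p.eval x - f x)
      (hη.ae_mem_Icc.mono fun x hx => (hp x hx).le)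
  have hL : ∀ p : Polynomial ℝ, Tendsto (fun n => momentFunctional (fun k => a n k) p) atTop
      (𝓝 (momentFunctional (fun k => m k) p)) := by
    intro p
    simp_rw [momentFunctional_apply]
    exact tendsto_finsetSum _ fun k _ => (ha k).const_mul _
  have hm0 : 0 ≤ m 0 := h.apply_zero ▸ measureReal_nonneg
  rw [Metric.tendsto_atTop]
  intro ε hε
  -- The three errors add up to at most `ε' * (a n 0 + 1 + m 0)`, and `a n 0 < m 0 + 1` eventually.
  set ε' := ε / (2 * m 0 + 3) with hε'
  have hε'0 : 0 < ε' := by positivity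
  obtain ⟨p, hp⟩ := exists_polynomial_near_of_continuousOn (-1) 1 f hf.continuousOn ε' hε'0
  obtain ⟨N, hN⟩ := Metric.tendsto_atTop.1 (hL p) ε' hε'0
  obtain ⟨N', hN'⟩ := Metric.tendsto_atTop.1 (ha 0) 1 one_pos
  refine ⟨max N N', fun n hn => ?_⟩
  have h1 := abs_le.1 (happrox (hν n) hp)
  have h2 := abs_le.1 (happrox h hp)
  have h3 := abs_lt.1 (hN n (le_of_max_le_left hn))
  have h4 := abs_lt.1 (hN' n (le_of_max_le_right hn))
  have h5 : ε' * a n 0 < ε' * (m 0 + 1) := by gcongr; linarith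
  have h6 : ε' * (m 0 + 1) + ε' * m 0 + ε' ≤ ε := by
    have : ε' * (2 * m 0 + 3) = ε := by rw [hε']; field_simp
    nlinarith
  rw [Real.dist_eq, abs_lt]
  constructor <;> linarith

theorem unique {μ' : Measure ℝ} (h : IsRepresentingMeasure μ m) (h' : IsRepresentingMeasure μ' m) :
    μ = μ' := by
  have := h.isFiniteMeasure
  have := h'.isFiniteMeasure
  refine Measure.ext_of_integral_eq_on_compactlySupported fun f => ?_
  -- Determinacy is the convergence theorem applied to a constant sequence of measures.
  exact tendsto_nhds_unique tendsto_const_nhds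
    (tendsto_integral (ν := fun _ => μ) (a := fun _ => m) (fun _ => h) h'
      (fun k => tendsto_const_nhds) f.continuous)

lemma of_measure_compl {C : Set ℝ} (hC : IsClosed C) (hC1 : C ⊆ Icc (-1) 1) [IsFiniteMeasure μ]
    (hμ : μ Cᶜ = 0) (h : ∀ k : ℤ, m k = ∫ x, x ^ k.natAbs ∂μ) :
    IsRepresentingMeasure μ m ∧ μ.support ⊆ C :=
  have hs : μ.support ⊆ C := Measure.support_subset_of_isClosed hC hμ
  ⟨⟨inferInstance, hs.trans hC1, h⟩, hs⟩

end IsRepresentingMeasure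

/-! ### The cone of moment sequences. -/

/-- Trades the existence of a measure for linear conditions on finitely many coordinates each;
closedness in the product topology and convexity are then immediate. -/
theorem mem_momentSpace_iff {C : Set ℝ} (hC : IsCompact C) (hC1 : C ⊆ Icc (-1) 1) {m : ℤ → ℝ} :
    m ∈ momentSpace C ↔ (∀ k, m (-k) = m k) ∧
      ∀ p : Polynomial ℝ, (∀ x ∈ C, 0 ≤ p.eval x) → 0 ≤ momentFunctional (fun k => m k) p := by
  constructor
  · rintro ⟨μ, hμ, hs⟩
    refine ⟨hμ.even, fun p hp => ?_⟩
    rw [hμ.momentFunctional_eq]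
    refine integral_nonneg_of_ae ?_
    have : ∀ᵐ x ∂μ, x ∈ μ.support := Measure.measure_compl_support
    exact this.mono fun x hx => hp x (hs hx)
  · rintro ⟨he, hp⟩
    obtain ⟨μ, hfin, hμ, hm⟩ := exists_measure_of_momentFunctional_nonneg hC _ hp
    refine ⟨μ, IsRepresentingMeasure.of_measure_compl hC.isClosed hC1 hμ fun k => ?_⟩
    rw [← hm]
    rcases Int.natAbs_eq k with h | h
    · rw [← h]
    · conv_lhs => rw [h, he]

theorem isClosed_momentSpace {C : Set ℝ} (hC : IsCompact C) (hC1 : C ⊆ Icc (-1) 1) :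
    IsClosed (momentSpace C) := by
  have : momentSpace C = (⋂ k : ℤ, {m | m (-k) = m k}) ∩
      ⋂ (p : Polynomial ℝ) (_ : ∀ x ∈ C, 0 ≤ p.eval x),
        {m : ℤ → ℝ | 0 ≤ momentFunctional (fun k => m k) p} := by
    ext m
    simp [mem_momentSpace_iff hC hC1]
  rw [this]
  refine (isClosed_iInter fun k => isClosed_eq (by fun_prop) (by fun_prop)).inter
    (isClosed_iInter fun p => isClosed_iInter fun _ => isClosed_le continuous_const ?_)
  simp_rw [momentFunctional_apply]
  fun_prop

lemma convex_momentSpace {C : Set ℝ} (hC : IsCompact C) (hC1 : C ⊆ Icc (-1) 1) :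
    Convex ℝ (momentSpace C) := by
  intro a ha b hb s t hs ht _
  rw [mem_momentSpace_iff hC hC1] at *
  refine ⟨fun k => by simp [ha.1, hb.1], fun p hp => ?_⟩
  have h1 := mul_nonneg hs (ha.2 p hp)
  have h2 := mul_nonneg ht (hb.2 p hp)
  rw [momentFunctional_apply, Finset.mul_sum] at h1 h2
  rw [momentFunctional_apply]
  refine (add_nonneg h1 h2).trans_eq ?_
  rw [← Finset.sum_add_distrib]
  refine Finset.sum_congr rfl fun k _ => ?_
  simp only [Pi.add_apply, Pi.smul_apply, smul_eq_mul]
  ring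

lemma zero_mem_momentSpace (C : Set ℝ) : (0 : ℤ → ℝ) ∈ momentSpace C :=
  ⟨0, ⟨inferInstance, by simp, by simp⟩, by simp⟩

lemma even_of_mem_momentSpace {C : Set ℝ} {m : ℤ → ℝ} (hm : m ∈ momentSpace C) (k : ℤ) :
    m (-k) = m k := by
  obtain ⟨μ, hμ, -⟩ := hm
  exact hμ.even k

lemma apply_zero_nonneg_of_mem_momentSpace {C : Set ℝ} {m : ℤ → ℝ} (hm : m ∈ momentSpace C) :
    0 ≤ m 0 := by
  obtain ⟨μ, hμ, -⟩ := hm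
  exact hμ.apply_zero ▸ measureReal_nonneg

/-- For `ρ < 1` this is the geometric decay supplied by the gap `δ`; for `ρ = 1` it says that `m`
peaks at `0`. -/
lemma abs_le_of_mem_momentSpace {C : Set ℝ} {ρ : ℝ} (hCρ : ∀ x ∈ C, |x| ≤ ρ) {m : ℤ → ℝ}
    (hm : m ∈ momentSpace C) (k : ℤ) : |m k| ≤ m 0 * ρ ^ k.natAbs := by
  obtain ⟨μ, hμ, hs⟩ := hm
  have := hμ.isFiniteMeasure
  rw [hμ.apply_zero, hμ.eq_integral, mul_comm]
  refine norm_integral_le_of_norm_le_const (μ := μ) (f := fun x : ℝ => x ^ k.natAbs) ?_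
  have : ∀ᵐ x ∂μ, x ∈ μ.support := Measure.measure_compl_support
  refine this.mono fun x hx => ?_
  rw [norm_pow, Real.norm_eq_abs]
  exact pow_le_pow_left₀ (abs_nonneg _) (hCρ x (hs hx)) _

/-! ### Spectral representation of the autocovariance. -/

section Spectral

open scoped InnerProductSpace

/-- The moments of a self-adjoint contraction at a vector form a moment sequence. -/
theorem exists_representingMeasure_of_isSelfAdjoint {E : Type*} [NormedAddCommGroup E]
    [InnerProductSpace ℂ E] [CompleteSpace E] {T : E →L[ℂ] E} (hT : IsSelfAdjoint T)
    (hT1 : ‖T‖ ≤ 1) (v : E) {m : ℤ → ℝ} (hm : ∀ k, m k = (⟪v, (T ^ k.natAbs) v⟫_ℂ).re) :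
    ∃ μ, IsRepresentingMeasure μ m := by
  suffices h : m ∈ momentSpace (Icc (-1) 1) by
    obtain ⟨μ, hμ, -⟩ := h
    exact ⟨μ, hμ⟩
  refine (mem_momentSpace_iff isCompact_Icc subset_rfl).2 ⟨fun k => by simp [hm], fun p hp => ?_⟩
  -- The spectrum lies in `[-1, 1]`, where `p ≥ 0`, so the functional calculus makes `p(T)` a
  -- positive operator.
  have hpos : 0 ≤ Polynomial.aeval T p := by
    rw [← cfc_polynomial p T]
    refine cfc_nonneg fun x hx => hp x ?_
    have := spectrum.subset_closedBall_norm_mul (𝕜 := ℝ) T hx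
    rw [mem_closedBall_zero_iff, Real.norm_eq_abs] at this
    have h1 : ‖(1 : E →L[ℂ] E)‖ ≤ 1 := ContinuousLinearMap.norm_id_le
    exact abs_le.1 (this.trans (mul_le_one₀ hT1 (norm_nonneg _) h1))
  have hre := ((ContinuousLinearMap.nonneg_iff_isPositive _).1 hpos).re_inner_nonneg_right v
  rw [Polynomial.aeval_eq_sum_range' (Nat.lt_succ_self _)] at hre
  rw [momentFunctional_apply, Finset.sum_subset (Polynomial.supp_subset_range (Nat.lt_succ_self _))]
  · convert hre
    simp only [hm, _root_.sum_apply, inner_sum, map_sum, Int.natAbs_natCast]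
    refine Finset.sum_congr rfl fun k _ => ?_
    rw [_root_.smul_apply, inner_smul_right_eq_smul]
    simp
  · intro k _ hk
    simp [Polynomial.notMem_support_iff.1 hk]

end Spectral

section Chain

variable {X : Type*} [MeasurableSpace X] {Q : Kernel X X} [IsMarkovKernel Q] {π : Measure X}
  [IsProbabilityMeasure π]

open scoped InnerProductSpace ComplexConjugate

lemma measurePreserving_fst (Q : Kernel X X) [IsMarkovKernel Q] (π : Measure X)
    [IsProbabilityMeasure π] : MeasurePreserving Prod.fst (π ⊗ₘ Q) π :=
  ⟨measurable_fst, Measure.fst_compProd π Q⟩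

lemma measurePreserving_swap (h : Q.IsReversible π) :
    MeasurePreserving Prod.swap (π ⊗ₘ Q) (π ⊗ₘ Q) := by
  refine ⟨measurable_swap, Measure.ext_prod fun {s t} hs ht => ?_⟩
  rw [Measure.map_apply measurable_swap (hs.prod ht), preimage_swap_prod,
    Measure.compProd_apply_prod ht hs, Measure.compProd_apply_prod hs ht, h ht hs]

lemma measurePreserving_snd (h : Q.IsReversible π) : MeasurePreserving Prod.snd (π ⊗ₘ Q) π :=
  (measurePreserving_fst Q π).comp (measurePreserving_swap h)

/-- The transition operator of a reversible chain on `L²`. -/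
noncomputable def transitionOp (h : Q.IsReversible π) : Lp ℂ 2 π →L[ℂ] Lp ℂ 2 π :=
  ContinuousLinearMap.adjoint (Lp.compMeasurePreservingₗᵢ ℂ Prod.fst
    (measurePreserving_fst Q π) : Lp ℂ 2 π →ₗᵢ[ℂ] Lp ℂ 2 (π ⊗ₘ Q)).toContinuousLinearMap ∘L
  (Lp.compMeasurePreservingₗᵢ ℂ Prod.snd (measurePreserving_snd h)).toContinuousLinearMap

/-- The operator is `U₁* U₂`, with `U₁`, `U₂` the isometric pullbacks along the coordinates of a
stationary one-step pair. Its bilinear form is therefore a one-step correlation, and reversibility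
becomes invariance under the swap. -/
lemma inner_transitionOp (h : Q.IsReversible π) (a b : Lp ℂ 2 π) :
    ⟪a, transitionOp h b⟫_ℂ = ⟪Lp.compMeasurePreserving Prod.fst (measurePreserving_fst Q π) a,
      Lp.compMeasurePreserving Prod.snd (measurePreserving_snd h) b⟫_ℂ := by
  rw [transitionOp, ContinuousLinearMap.comp_apply, ContinuousLinearMap.adjoint_inner_right]
  rfl

lemma norm_transitionOp_le (h : Q.IsReversible π) : ‖transitionOp h‖ ≤ 1 := by
  refine (ContinuousLinearMap.opNorm_comp_le _ _).trans (mul_le_one₀ ?_ (norm_nonneg _) ?_)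
  · rw [LinearIsometryEquiv.norm_map]
    exact LinearIsometry.norm_toContinuousLinearMap_le _
  · exact LinearIsometry.norm_toContinuousLinearMap_le _

lemma isSelfAdjoint_transitionOp (h : Q.IsReversible π) : IsSelfAdjoint (transitionOp h) := by
  rw [ContinuousLinearMap.isSelfAdjoint_iff_isSymmetric]
  intro a b
  change ⟪transitionOp h a, b⟫_ℂ = ⟪a, transitionOp h b⟫_ℂ
  have hS := (Lp.compMeasurePreservingₗᵢ (p := 2) (E := ℂ) ℂ Prod.swap
    (measurePreserving_swap h)).inner_map_map
  rw [← inner_conj_symm, inner_transitionOp, inner_transitionOp, inner_conj_symm, ← hS]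
  congr 1
  · exact (Lp.compMeasurePreserving_comp_apply a _ _).symm
  · exact (Lp.compMeasurePreserving_comp_apply b _ _).symm

/-- Identifies the abstract operator with averaging along `Q`, by testing both sides against
indicators. -/
lemma transitionOp_ae_eq (h : Q.IsReversible π) (b : Lp ℂ 2 π) :
    transitionOp h b =ᵐ[π] fun x => ∫ y, b y ∂(Q x) := by
  have hb : Integrable (fun z : X × X => b z.2) (π ⊗ₘ Q) :=
    (measurePreserving_snd h).integrable_comp_of_integrable
      ((Lp.memLp b).integrable one_le_two)
  refine Integrable.ae_eq_of_forall_setIntegral_eq _ _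
    ((Lp.memLp _).integrable one_le_two) ?_ fun s hs _ => ?_
  · simpa [Measure.compProd] using Integrable.integral_compProd (κ := Kernel.const Unit π)
      (η := Kernel.prodMkLeft Unit Q) (a := ()) hb
  · rw [← L2.inner_indicatorConstLp_one hs (measure_ne_top _ _), inner_transitionOp,
      Lp.indicatorConstLp_compMeasurePreserving, L2.inner_indicatorConstLp_one,
      setIntegral_congr_ae (g := fun z : X × X => b z.2) (measurable_fst hs)
        ((Lp.coeFn_compMeasurePreserving b (measurePreserving_snd h)).mono fun x hx _ => hx)]
    have := Measure.setIntegral_compProd hs MeasurableSet.univ (μ := π) (κ := Q)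
      (f := fun z : X × X => b z.2) hb.integrableOn
    rw [prod_univ] at this
    simpa using this

/-- The Markov property in the form used below: given the history up to time `n`, the next state is
drawn from `Q` at the current one. -/
lemma map_frestrictLe_compProd_historyKernel (Q : Kernel X X) [IsMarkovKernel Q] (π : Measure X)
    [IsProbabilityMeasure π] (n : ℕ) :
    (chainLaw Q π).map (Preorder.frestrictLe n) ⊗ₘ historyKernel Q n =
      (chainLaw Q π).map (fun p => (Preorder.frestrictLe n p, p (n + 1))) :=
  Kernel.map_frestrictLe_trajMeasure_compProd_eq_map_trajMeasure (X := fun _ => X)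

instance (Q : Kernel X X) [IsMarkovKernel Q] (ν : Measure X) [IsProbabilityMeasure ν] :
    IsProbabilityMeasure (chainLaw Q ν) := by
  unfold chainLaw
  infer_instance

lemma measurePreserving_eval (h : Q.Invariant π) (n : ℕ) :
    MeasurePreserving (fun p : ℕ → X => p n) (chainLaw Q π) π := by
  induction n with
  | zero =>
    refine ⟨measurable_pi_apply 0, ?_⟩
    have h0 : (fun p : ℕ → X => p 0) = (fun z : (i : Finset.Iic 0) → X => z ⟨0, by simp⟩) ∘
        Preorder.frestrictLe (π := fun _ => X) 0 := rfl
    have hm : Measurable fun z : (i : Finset.Iic 0) → X => z ⟨0, by simp⟩ := by fun_prop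
    rw [h0, ← Measure.map_map hm (Preorder.measurable_frestrictLe 0),
      chainLaw, Kernel.trajMeasure, Measure.map_comp _ _ (Preorder.measurable_frestrictLe 0),
      Kernel.traj_map_frestrictLe, Kernel.partialTraj_self, Measure.id_comp,
      Measure.map_map hm (MeasurableEquiv.measurable _)]
    convert Measure.map_id
    rfl
  | succ n ih =>
    refine ⟨measurable_pi_apply _, ?_⟩
    have h1 : (fun p : ℕ → X => p (n + 1)) =
        Prod.snd ∘ fun p : ℕ → X => (Preorder.frestrictLe (π := fun _ => X) n p, p (n + 1)) := rfl
    rw [h1, ← Measure.map_map measurable_snd (by fun_prop),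
      ← map_frestrictLe_compProd_historyKernel]
    change Measure.snd _ = _
    rw [Measure.snd_compProd]
    ext t ht
    rw [Measure.bind_apply ht (Kernel.aemeasurable _),
      lintegral_map (Kernel.measurable_coe _ ht) (Preorder.measurable_frestrictLe n)]
    change ∫⁻ p, Q (p n) t ∂(chainLaw Q π) = π t
    rw [← lintegral_map (μ := chainLaw Q π) (g := fun p : ℕ → X => p n)
      (Kernel.measurable_coe Q ht) (measurable_pi_apply n), ih.map_eq,
      ← Measure.bind_apply ht (Kernel.aemeasurable _), h.def]

lemma integrable_conj_mul {Ω : Type*} [MeasurableSpace Ω] {P : Measure Ω} {a b : Ω → ℂ}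
    (ha : MemLp a 2 P) (hb : MemLp b 2 P) : Integrable (fun ω => conj (a ω) * b ω) P :=
  MemLp.integrable_mul ha.star hb

/-- Conditioning on the history up to time `n` trades one time step for one application of the
operator; iterating gives the powers. -/
lemma integral_conj_mul_transitionOp (h : Q.IsReversible π) (a b : Lp ℂ 2 π) (n : ℕ) :
    ∫ p, conj (a (p 0)) * b (p (n + 1)) ∂(chainLaw Q π) =
      ∫ p, conj (a (p 0)) * transitionOp h b (p n) ∂(chainLaw Q π) := by
  have hi := measurePreserving_eval h.invariant
  have hma := (Lp.stronglyMeasurable a).measurable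
  have hmb := (Lp.stronglyMeasurable b).measurable
  have hint : Integrable (fun p : ℕ → X => conj (a (p 0)) * b (p (n + 1))) (chainLaw Q π) :=
    integrable_conj_mul ((Lp.memLp a).comp_measurePreserving (hi 0))
      ((Lp.memLp b).comp_measurePreserving (hi (n + 1)))
  let F : ((i : Finset.Iic n) → X) × X → ℂ := fun z => conj (a (z.1 ⟨0, by simp⟩)) * b z.2
  have hF : Measurable F := by
    have : Measurable fun z : ((i : Finset.Iic n) → X) × X => a (z.1 ⟨0, by simp⟩) :=
      hma.comp (by fun_prop)
    exact (Complex.continuous_conj.measurable.comp this).mul (hmb.comp measurable_snd)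
  have hpair : Measurable fun p : ℕ → X => (Preorder.frestrictLe (π := fun _ => X) n p, p (n + 1)) :=
    by fun_prop
  have h1 : ∫ p, conj (a (p 0)) * b (p (n + 1)) ∂(chainLaw Q π) =
      ∫ z, F z ∂((chainLaw Q π).map (Preorder.frestrictLe n) ⊗ₘ historyKernel Q n) := by
    rw [map_frestrictLe_compProd_historyKernel, integral_map hpair.aemeasurable
      hF.aestronglyMeasurable]
    rfl
  have hFint : Integrable F
      ((chainLaw Q π).map (Preorder.frestrictLe n) ⊗ₘ historyKernel Q n) := by
    rw [map_frestrictLe_compProd_historyKernel,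
      integrable_map_measure hF.aestronglyMeasurable hpair.aemeasurable]
    exact hint
  rw [h1, Measure.integral_compProd hFint, integral_map
    (Preorder.measurable_frestrictLe n).aemeasurable
    hF.stronglyMeasurable.integral_kernel_prod_right'.aestronglyMeasurable]
  refine integral_congr_ae ?_
  filter_upwards [(hi n).quasiMeasurePreserving.ae_eq (transitionOp_ae_eq h b)] with p hp
  have hp' : transitionOp h b (p n) = ∫ y, b y ∂(Q (p n)) := hp
  rw [hp', ← integral_const_mul]
  rfl

lemma integral_conj_mul_eq_inner (h : Q.IsReversible π) (a b : Lp ℂ 2 π) (n : ℕ) :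
    ∫ p, conj (a (p 0)) * b (p n) ∂(chainLaw Q π) = ⟪a, (transitionOp h ^ n) b⟫_ℂ := by
  induction n generalizing b with
  | zero =>
    have hi := measurePreserving_eval h.invariant 0
    have hm : AEStronglyMeasurable (fun x => conj (a x) * b x)
        ((chainLaw Q π).map fun p => p 0) := by
      rw [hi.map_eq]
      exact (integrable_conj_mul (Lp.memLp a) (Lp.memLp b)).aestronglyMeasurable
    rw [← integral_map (φ := fun p : ℕ → X => p 0) (f := fun x => conj (a x) * b x)
      hi.aemeasurable hm, hi.map_eq, L2.inner_def]
    simp [mul_comm]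
  | succ n ih =>
    rw [integral_conj_mul_transitionOp h, ih, pow_succ]
    rfl

/-- The autocovariance sequence of a reversible chain is a moment sequence. -/
theorem exists_representingMeasure_autocov (h : Q.IsReversible π) {g : X → ℝ}
    (hg2 : MemLp g 2 π) : ∃ μ, IsRepresentingMeasure μ (autocov Q π g) := by
  have hi := measurePreserving_eval h.invariant
  set c : ℝ := ∫ x, g x ∂π with hc
  -- By stationarity `g` has mean `c` at every time, so the covariances are inner products against
  -- the single vector `g - c`.
  have hgc : MemLp (fun x => ((g x - c : ℝ) : ℂ)) 2 π := (hg2.sub (memLp_const c)).ofReal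
  have hmean : ∀ n, ∫ p, g (p n) ∂(chainLaw Q π) = c := by
    intro n
    have hm : AEStronglyMeasurable g ((chainLaw Q π).map fun p => p n) := by
      rw [(hi n).map_eq]
      exact hg2.aestronglyMeasurable
    rw [← integral_map (φ := fun p : ℕ → X => p n) (hi n).aemeasurable hm, (hi n).map_eq]
  refine exists_representingMeasure_of_isSelfAdjoint (isSelfAdjoint_transitionOp h)
    (norm_transitionOp_le h) (hgc.toLp _) fun k => ?_
  rw [← integral_conj_mul_eq_inner, autocov, covariance, hmean, hmean]
  have hae : ∀ n, ∀ᵐ p ∂(chainLaw Q π), hgc.toLp _ (p n) = ((g (p n) - c : ℝ) : ℂ) := fun n =>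
    (hi n).quasiMeasurePreserving.ae_eq hgc.coeFn_toLp
  have : ∫ p, conj (hgc.toLp _ (p 0)) * hgc.toLp _ (p k.natAbs) ∂(chainLaw Q π) =
      ∫ p, (((g (p 0) - c) * (g (p k.natAbs) - c) : ℝ) : ℂ) ∂(chainLaw Q π) := by
    refine integral_congr_ae ?_
    filter_upwards [hae 0, hae k.natAbs] with p h0 hk
    rw [h0, hk, Complex.conj_ofReal, Complex.ofReal_mul]
  rw [this, integral_complex_ofReal, Complex.ofReal_re]

end Chain

/-! ### Cosine series and the Fourier transform. -/

/-- The even absolutely summable sequences. -/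
def evenSummable : Submodule ℝ (ℤ → ℝ) where
  carrier := {m | (∀ k, m (-k) = m k) ∧ Summable m}
  add_mem' := fun ha hb => ⟨fun k => by simp [ha.1, hb.1], ha.2.add hb.2⟩
  zero_mem' := ⟨fun _ => rfl, summable_zero⟩
  smul_mem' := fun c _ ha => ⟨fun k => by simp [ha.1], ha.2.const_smul c⟩

/-- The cosine series `∑ₖ m(k) cos(kω)`. -/
noncomputable def cosSeries (m : ℤ → ℝ) (ω : ℝ) : ℝ := ∑' k : ℤ, m k * Real.cos (k * ω)

lemma norm_mul_cos_le (a x : ℝ) : ‖a * Real.cos x‖ ≤ ‖a‖ := by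
  rw [norm_mul]
  exact mul_le_of_le_one_right (norm_nonneg _) (Real.abs_cos_le_one _)

lemma summable_mul_cos {m : ℤ → ℝ} (hm : Summable m) (ω : ℝ) :
    Summable fun k : ℤ => m k * Real.cos (k * ω) :=
  .of_norm_bounded hm.norm fun _ => norm_mul_cos_le _ _

lemma continuous_cosSeries {m : ℤ → ℝ} (hm : Summable m) : Continuous (cosSeries m) :=
  continuous_tsum (fun k => by fun_prop) hm.norm fun _ _ => norm_mul_cos_le _ _

lemma cosSeries_add {u v : ℤ → ℝ} (hu : Summable u) (hv : Summable v) (ω : ℝ) :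
    cosSeries (u + v) ω = cosSeries u ω + cosSeries v ω := by
  unfold cosSeries
  rw [← (summable_mul_cos hu ω).tsum_add (summable_mul_cos hv ω)]
  simp [add_mul]

lemma cosSeries_smul (c : ℝ) (u : ℤ → ℝ) (ω : ℝ) :
    cosSeries (c • u) ω = c * cosSeries u ω := by
  simp [cosSeries, ← tsum_mul_left, mul_assoc]

section FourierTransform

open AddCircle

lemma fourier_coe_two_pi (k : ℤ) (ω : ℝ) :
    fourier k (ω : AddCircle (2 * Real.pi)) = Complex.exp (k * ω * Complex.I) := by
  rw [fourier_coe_apply]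
  congr 1
  have : (Real.pi : ℂ) ≠ 0 := by exact_mod_cast Real.pi_ne_zero
  push_cast
  field_simp

/-- Absolute summability makes the Fourier series converge uniformly, so its `L²` class has a
continuous representative, and evenness turns the exponentials into cosines. -/
lemma fourierTransform_ae_eq {m : ℤ → ℝ} (hm : m ∈ evenSummable) :
    ∀ᵐ ω : ℝ ∂volume.restrict (Icc (-Real.pi) Real.pi),
      fourierTransform m (ω : AddCircle (2 * Real.pi)) = (cosSeries m ω : ℂ) := by
  have hsum : Summable fun k : ℤ => (m k : ℂ) • (fourier (-k) : C(AddCircle (2 * Real.pi), ℂ)) := by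
    refine .of_norm (hm.2.norm.congr fun k => ?_)
    rw [norm_smul, fourier_norm, Complex.norm_real, mul_one]
  set F : C(AddCircle (2 * Real.pi), ℂ) := ∑' k : ℤ, (m k : ℂ) • fourier (-k) with hF
  have hT : fourierTransform m = ContinuousMap.toLp 2 haarAddCircle ℂ F := by
    rw [hF, ContinuousLinearMap.map_tsum _ hsum]
    exact tsum_congr fun k => (map_smul (ContinuousMap.toLp 2 haarAddCircle ℂ) _ _).symm
  have hFω : ∀ ω : ℝ, F (ω : AddCircle (2 * Real.pi)) = (cosSeries m ω : ℂ) := by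
    intro ω
    have h1 : HasSum (fun k : ℤ => (m k : ℂ) * Complex.exp (((-k : ℤ) : ℂ) * ω * Complex.I))
        (F ω) := by
      have := (ContinuousMap.evalCLM ℂ (ω : AddCircle (2 * Real.pi))).hasSum hsum.hasSum
      rw [← hF] at this
      simp_rw [← fourier_coe_two_pi]
      exact this
    have h2 : HasSum (fun k : ℤ => (m k : ℂ) * Complex.exp ((k : ℂ) * ω * Complex.I)) (F ω) := by
      rw [← (Equiv.neg ℤ).hasSum_iff]
      simpa [Function.comp_def, hm.1] using h1
    have h3 : HasSum (fun k : ℤ => ((m k * Real.cos (k * ω) : ℝ) : ℂ)) (cosSeries m ω : ℂ) :=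
      Complex.hasSum_ofReal.2 (summable_mul_cos hm.2 ω).hasSum
    -- Averaging the series with its reflection `k ↦ -k` produces the cosines.
    have h4 := (h1.add h2).mul_left (1 / 2 : ℂ)
    have h5 : F ω = 1 / 2 * (F ω + F ω) := by ring
    rw [h5]
    refine h4.unique (h3.congr_fun fun k => ?_)
    push_cast
    rw [Complex.cos]
    simp only [neg_mul]
    ring
  have hae : ∀ᵐ z ∂(volume : Measure (AddCircle (2 * Real.pi))), fourierTransform m z = F z := by
    rw [volume_eq_smul_haarAddCircle, hT]
    exact Measure.ae_smul_measure (ContinuousMap.coeFn_toLp haarAddCircle F) _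
  have hmp := AddCircle.measurePreserving_mk (2 * Real.pi) (-Real.pi)
  rw [show -Real.pi + 2 * Real.pi = Real.pi by ring] at hmp
  rw [← restrict_Ioc_eq_restrict_Icc]
  filter_upwards [hmp.quasiMeasurePreserving.ae hae] with ω hω
  rw [hω, hFω]

lemma abs_le_norm_fourierTransform {m : ℤ → ℝ} (hm : Summable m) (k : ℤ) :
    |m k| ≤ ‖fourierTransform m‖ := by
  have hsum : Summable fun k : ℤ => (m k : ℂ) •
      (fourierLp 2 (-k) : Lp ℂ 2 (haarAddCircle (T := 2 * Real.pi))) := by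
    refine .of_norm (hm.norm.congr fun k => ?_)
    rw [norm_smul, orthonormal_fourier.1, Complex.norm_real, mul_one]
  have hin : inner ℂ (fourierLp 2 (-k)) (fourierTransform m) = (m k : ℂ) := by
    rw [fourierTransform]
    have h := (innerSL ℂ
      (fourierLp 2 (-k) : Lp ℂ 2 (haarAddCircle (T := 2 * Real.pi)))).hasSum hsum.hasSum
    refine h.unique ((hasSum_ite_eq k (m k : ℂ)).congr_fun fun j => ?_)
    rw [innerSL_apply_apply, inner_smul_right, orthonormal_iff_ite.1 orthonormal_fourier]
    by_cases hj : j = k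
    · simp [hj]
    · simp [hj, Ne.symm hj]
  have := norm_inner_le_norm (𝕜 := ℂ) (fourierLp 2 (-k)) (fourierTransform m)
  rw [hin, orthonormal_fourier.1, one_mul, Complex.norm_real] at this
  exact this

lemma norm_fourierTransform_sq {m : ℤ → ℝ} (hm : m ∈ evenSummable) :
    ‖fourierTransform m‖ ^ 2 = (2 * Real.pi)⁻¹ * ∫ ω in -Real.pi..Real.pi, cosSeries m ω ^ 2 := by
  have h1 : ‖fourierTransform m‖ ^ 2 = ∫ z, ‖fourierTransform m z‖ ^ 2 ∂haarAddCircle := by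
    rw [← RCLike.ofReal_inj (K := ℂ)]
    push_cast
    rw [← inner_self_eq_norm_sq_to_K (𝕜 := ℂ), L2.inner_def, ← integral_ofReal]
    simp [inner_self_eq_norm_sq_to_K]
  rw [h1, integral_haarAddCircle, ← AddCircle.intervalIntegral_preimage (2 * Real.pi) (-Real.pi),
    show -Real.pi + 2 * Real.pi = Real.pi by ring, smul_eq_mul]
  congr 1
  have hpi : -Real.pi ≤ Real.pi := by linarith [Real.pi_pos]
  rw [intervalIntegral.integral_of_le hpi, intervalIntegral.integral_of_le hpi]
  refine integral_congr_ae ?_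
  rw [restrict_Ioc_eq_restrict_Icc]
  filter_upwards [fourierTransform_ae_eq hm] with ω hω
  rw [hω]
  simp

end FourierTransform

/-! ### The weighted inner product. -/

/-- The bilinear form of the weighted norm. -/
noncomputable def weightedInner (φ : ℝ → ℝ) (u v : ℤ → ℝ) : ℝ :=
  (2 * Real.pi)⁻¹ * ∫ ω in -Real.pi..Real.pi, cosSeries u ω * (cosSeries v ω * (φ ω ^ 2)⁻¹)

namespace IsWeight

variable {φ : ℝ → ℝ}

lemma pos (hφ : IsWeight φ) (ω : ℝ) : 0 < φ ω := by
  obtain ⟨c₀, c₁, h0, h⟩ := hφ.bounded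
  exact h0.trans_le (h ω).1

lemma continuous_inv_sq (hφ : IsWeight φ) : Continuous fun ω => (φ ω ^ 2)⁻¹ :=
  (hφ.contDiff.continuous.pow 2).inv₀ fun ω => (pow_pos (hφ.pos ω) 2).ne'

end IsWeight

section WeightedInner

variable {φ : ℝ → ℝ} {u v w : ℤ → ℝ}

lemma weightedNormSq_eq_weightedInner (hu : u ∈ evenSummable) :
    weightedNormSq φ u = weightedInner φ u u := by
  unfold weightedNormSq weightedInner
  congr 1
  rw [intervalIntegral.integral_of_le (by linarith [Real.pi_pos]),
    ← restrict_Ioc_eq_restrict_Icc]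
  refine integral_congr_ae ?_
  rw [restrict_Ioc_eq_restrict_Icc]
  filter_upwards [fourierTransform_ae_eq hu] with ω hω
  rw [hω]
  simp only [Complex.norm_real, Real.norm_eq_abs, sq_abs]
  ring

lemma weightedInner_comm (φ : ℝ → ℝ) (u v : ℤ → ℝ) :
    weightedInner φ u v = weightedInner φ v u := by
  unfold weightedInner
  congr 2
  ext ω
  ring

lemma weightedInner_add_left (hφ : IsWeight φ) (hu : Summable u) (hv : Summable v)
    (hw : Summable w) :
    weightedInner φ (u + v) w = weightedInner φ u w + weightedInner φ v w := by
  unfold weightedInner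
  have := hφ.continuous_inv_sq
  have := continuous_cosSeries hu
  have := continuous_cosSeries hv
  have := continuous_cosSeries hw
  rw [← mul_add, ← intervalIntegral.integral_add
    ((by fun_prop : Continuous _).intervalIntegrable _ _)
    ((by fun_prop : Continuous _).intervalIntegrable _ _)]
  simp_rw [cosSeries_add hu hv, add_mul]

lemma weightedInner_smul_left (c : ℝ) :
    weightedInner φ (c • u) w = c * weightedInner φ u w := by
  unfold weightedInner
  simp_rw [cosSeries_smul, mul_assoc, intervalIntegral.integral_const_mul]
  ring

lemma weightedInner_sub_left (hφ : IsWeight φ) (hu : Summable u) (hv : Summable v)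
    (hw : Summable w) :
    weightedInner φ (u - v) w = weightedInner φ u w - weightedInner φ v w := by
  have huv : Summable (u - v) := hu.sub hv
  have h := weightedInner_add_left hφ huv hv hw
  rw [sub_add_cancel] at h
  linarith

/-- Split `v - w = (u - w) - (u - v)` in the first slot. With `u` the input and `v` the minimizer,
optimality makes the last term nonpositive for every competitor `w`. -/
lemma weightedInner_sub_self (hφ : IsWeight φ) (hu : Summable u) (hv : Summable v)
    (hw : Summable w) : weightedInner φ (v - w) (v - w) =
      weightedInner φ (u - w) (v - w) + weightedInner φ (u - v) (w - v) := by
  have hvw : Summable (v - w) := hv.sub hw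
  have hneg : weightedInner φ (u - v) (w - v) = -weightedInner φ (u - v) (v - w) := by
    rw [weightedInner_comm, ← neg_sub v w, ← neg_one_smul ℝ (v - w), weightedInner_smul_left,
      weightedInner_comm]
    ring
  rw [hneg, weightedInner_sub_left hφ hv hw hvw, weightedInner_sub_left hφ hu hw hvw,
    weightedInner_sub_left hφ hu hv hvw]
  ring

lemma weightedInner_self_add_smul (hφ : IsWeight φ) (hu : Summable u) (hv : Summable v) (t : ℝ) :
    weightedInner φ (u + t • v) (u + t • v) =
      weightedInner φ u u + 2 * t * weightedInner φ u v + t ^ 2 * weightedInner φ v v := by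
  have htv : Summable (t • v) := hv.const_smul t
  have hutv : Summable (u + t • v) := hu.add htv
  rw [weightedInner_add_left hφ hu htv hutv, weightedInner_comm φ u,
    weightedInner_comm φ (t • v), weightedInner_add_left hφ hu htv hu,
    weightedInner_add_left hφ hu htv htv]
  rw [weightedInner_comm φ u (t • v), weightedInner_smul_left, weightedInner_smul_left,
    weightedInner_comm φ v (t • v), weightedInner_smul_left, weightedInner_comm φ v u]
  ring

/-- A coordinate is a Fourier coefficient, hence bounded by the unweighted `L²` norm, which an upper
bound on `φ` compares with the weighted one. -/
lemma sq_apply_le (hφ : IsWeight φ) {c : ℝ} (hc : ∀ ω ∈ Icc (-Real.pi) Real.pi, φ ω ≤ c)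
    (hu : u ∈ evenSummable) (k : ℤ) : u k ^ 2 ≤ c ^ 2 * weightedInner φ u u := by
  have hk : u k ^ 2 ≤ ‖fourierTransform u‖ ^ 2 := by
    rw [← sq_abs]
    exact pow_le_pow_left₀ (abs_nonneg _) (abs_le_norm_fourierTransform hu.2 k) 2
  refine hk.trans ?_
  rw [norm_fourierTransform_sq hu, weightedInner, mul_left_comm]
  have hpi := Real.pi_pos
  gcongr
  rw [← intervalIntegral.integral_const_mul]
  have h1 := hφ.continuous_inv_sq
  have h2 := continuous_cosSeries hu.2
  refine intervalIntegral.integral_mono_on (by linarith)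
    ((by fun_prop : Continuous _).intervalIntegrable _ _)
    ((by fun_prop : Continuous _).intervalIntegrable _ _) fun ω hω => ?_
  have h3 := hφ.pos ω
  have h4 : φ ω ^ 2 ≤ c ^ 2 := pow_le_pow_left₀ h3.le (hc ω hω) 2
  have h5 : 1 ≤ c ^ 2 * (φ ω ^ 2)⁻¹ := by
    rw [← div_eq_mul_inv, one_le_div (by positivity)]
    exact h4
  nlinarith [mul_le_mul_of_nonneg_left h5 (sq_nonneg (cosSeries u ω))]

/-! ### Duality between weak and strong sequence norms. -/

lemma hasSum_integral_cosSeries_mul (hu : Summable u) {h : ℝ → ℝ} (hh : Continuous h) (a b : ℝ) :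
    HasSum (fun k : ℤ => u k * ∫ ω in a..b, Real.cos (k * ω) * h ω)
      (∫ ω in a..b, cosSeries u ω * h ω) := by
  obtain ⟨K, hK⟩ := (isCompact_uIcc (a := a) (b := b)).exists_bound_of_continuousOn
    hh.continuousOn
  have := intervalIntegral.hasSum_integral_of_dominated_convergence (μ := volume) (a := a) (b := b)
    (F := fun (k : ℤ) ω => u k * (Real.cos (k * ω) * h ω)) (f := fun ω => cosSeries u ω * h ω)
    (fun k _ => |u k| * K) (fun k => Continuous.aestronglyMeasurable (by fun_prop))
    (fun k => ae_of_all _ fun ω hω => ?_) (ae_of_all _ fun ω hω => hu.abs.mul_right K)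
    (by simp) (ae_of_all _ fun ω hω => ?_)
  · simpa only [intervalIntegral.integral_const_mul] using this
  · rw [← mul_assoc, norm_mul]
    exact mul_le_mul (norm_mul_cos_le _ _) (hK ω (uIoc_subset_uIcc hω)) (norm_nonneg _)
      (abs_nonneg _)
  · simp_rw [← mul_assoc]
    exact (summable_mul_cos hu ω).hasSum.mul_right _

/-- Two integrations by parts give quadratic decay of the cosine coefficients. -/
lemma abs_integral_cos_mul_le {h h' h'' : ℝ → ℝ} (h1 : ∀ x, HasDerivAt h (h' x) x)
    (h2 : ∀ x, HasDerivAt h' (h'' x) x) (h3 : Continuous h'') (hper' : h' Real.pi = h' (-Real.pi))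
    {A A' : ℝ} (hA : ∀ ω ∈ Icc (-Real.pi) Real.pi, |h ω| ≤ A)
    (hA' : ∀ ω ∈ Icc (-Real.pi) Real.pi, |h'' ω| ≤ A') (k : ℤ) :
    |∫ ω in -Real.pi..Real.pi, Real.cos (k * ω) * h ω| ≤ 2 * Real.pi * (A + A') / (1 + k ^ 2) := by
  have hpi := Real.pi_pos
  have hbound : ∀ {f : ℝ → ℝ} {B : ℝ} (_ : ∀ ω ∈ Icc (-Real.pi) Real.pi, |f ω| ≤ B),
      |∫ ω in -Real.pi..Real.pi, Real.cos (k * ω) * f ω| ≤ 2 * Real.pi * B := by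
    intro f B hf
    have := intervalIntegral.norm_integral_le_of_norm_le_const (a := -Real.pi) (b := Real.pi)
      (f := fun ω => Real.cos (k * ω) * f ω) (C := B) fun ω hω => ?_
    · rw [abs_of_nonneg (by linarith)] at this
      rw [← Real.norm_eq_abs]
      linarith
    · rw [uIoc_of_le (by linarith)] at hω
      rw [mul_comm]
      exact (norm_mul_cos_le _ _).trans (hf ω (Ioc_subset_Icc_self hω))
  have hh' : Continuous h' := continuous_iff_continuousAt.2 fun x => (h2 x).continuousAt
  have hparts : (k : ℝ) ^ 2 * ∫ ω in -Real.pi..Real.pi, Real.cos (k * ω) * h ω =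
      -∫ ω in -Real.pi..Real.pi, Real.cos (k * ω) * h'' ω := by
    have hlin : ∀ x : ℝ, HasDerivAt (fun x : ℝ => (k : ℝ) * x) k x := fun x => by
      simpa using (hasDerivAt_id x).const_mul (k : ℝ)
    have e1 := intervalIntegral.integral_mul_deriv_eq_deriv_mul (a := -Real.pi) (b := Real.pi)
      (u := h) (u' := h') (v := fun ω => Real.sin (k * ω)) (v' := fun ω => Real.cos (k * ω) * k)
      (fun x _ => h1 x) (fun x _ => (hlin x).sin) (hh'.intervalIntegrable _ _)
      ((by fun_prop : Continuous _).intervalIntegrable _ _)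
    have e2 := intervalIntegral.integral_mul_deriv_eq_deriv_mul (a := -Real.pi) (b := Real.pi)
      (u := h') (u' := h'') (v := fun ω => -Real.cos (k * ω))
      (v' := fun ω => -(-Real.sin (k * ω) * k))
      (fun x _ => h2 x) (fun x _ => (hlin x).cos.neg) (h3.intervalIntegrable _ _)
      ((by fun_prop : Continuous _).intervalIntegrable _ _)
    have i1 : ∫ ω in -Real.pi..Real.pi, h ω * (Real.cos (k * ω) * k) =
        k * ∫ ω in -Real.pi..Real.pi, Real.cos (k * ω) * h ω := by
      rw [← intervalIntegral.integral_const_mul]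
      congr 1 with ω
      ring
    have i2 : ∫ ω in -Real.pi..Real.pi, h' ω * -(-Real.sin (k * ω) * k) =
        k * ∫ ω in -Real.pi..Real.pi, h' ω * Real.sin (k * ω) := by
      rw [← intervalIntegral.integral_const_mul]
      congr 1 with ω
      ring
    have i3 : ∫ ω in -Real.pi..Real.pi, h'' ω * -Real.cos (k * ω) =
        -∫ ω in -Real.pi..Real.pi, Real.cos (k * ω) * h'' ω := by
      rw [← intervalIntegral.integral_neg]
      congr 1 with ω
      ring
    rw [i1] at e1
    rw [i2, i3] at e2
    simp only [mul_neg, Real.cos_neg, Real.sin_neg, Real.sin_int_mul_pi, mul_zero, neg_zero,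
      sub_zero, zero_sub, hper'] at e1 e2
    rw [sq, mul_assoc, e1]
    linear_combination -e2
  have hk : (0 : ℝ) < 1 + k ^ 2 := by positivity
  rw [le_div_iff₀ hk, ← abs_of_pos hk, ← abs_mul, mul_add, mul_one, mul_comm _ ((k : ℝ) ^ 2), hparts]
  refine (abs_add_le _ _).trans ?_
  rw [abs_neg, mul_add]
  exact add_le_add (hbound hA) (hbound hA')

/-- Two derivatives fall on `cos(jω) ψ(ω)` and cost at most a factor of order `1 + j²`. The decay in
`k` will weaken the norm on one argument, the growth in `j` strengthens it on the other. -/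
lemma abs_integral_cos_mul_cos_mul_le {ψ ψ' ψ'' : ℝ → ℝ} (h1 : ∀ x, HasDerivAt ψ (ψ' x) x)
    (h2 : ∀ x, HasDerivAt ψ' (ψ'' x) x) (h3 : Continuous ψ'')
    (hper' : ψ' Real.pi = ψ' (-Real.pi)) {K : ℝ} (hK : ∀ ω ∈ Icc (-Real.pi) Real.pi, |ψ ω| ≤ K)
    (hK' : ∀ ω ∈ Icc (-Real.pi) Real.pi, |ψ' ω| ≤ K)
    (hK'' : ∀ ω ∈ Icc (-Real.pi) Real.pi, |ψ'' ω| ≤ K) (k j : ℤ) :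
    |∫ ω in -Real.pi..Real.pi, Real.cos (k * ω) * (Real.cos (j * ω) * ψ ω)| ≤
      2 * Real.pi * (3 * K * (1 + j ^ 2)) / (1 + k ^ 2) := by
  have hlin : ∀ x : ℝ, HasDerivAt (fun x : ℝ => (j : ℝ) * x) j x := fun x => by
    simpa using (hasDerivAt_id x).const_mul (j : ℝ)
  have hψ : Continuous ψ := continuous_iff_continuousAt.2 fun x => (h1 x).continuousAt
  have hψ' : Continuous ψ' := continuous_iff_continuousAt.2 fun x => (h2 x).continuousAt
  have hcos : ∀ (x a : ℝ), |Real.cos x * a| ≤ |a| := fun x a => by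
    rw [mul_comm]; exact norm_mul_cos_le a x
  have hsin : ∀ (x a : ℝ), |Real.sin x * a| ≤ |a| := fun x a => by
    rw [abs_mul]; exact mul_le_of_le_one_left (abs_nonneg _) (Real.abs_sin_le_one _)
  have hK0 : 0 ≤ K := (abs_nonneg _).trans (hK 0 (by simp [Real.pi_pos.le]))
  refine (abs_integral_cos_mul_le (A := K) (A' := K * (2 + 2 * j ^ 2))
    (h' := fun ω => -Real.sin (j * ω) * j * ψ ω + Real.cos (j * ω) * ψ' ω)
    (h'' := fun ω => -(Real.cos (j * ω) * j) * j * ψ ω + -Real.sin (j * ω) * j * ψ' ω +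
      (-Real.sin (j * ω) * j * ψ' ω + Real.cos (j * ω) * ψ'' ω))
    (fun x => (hlin x).cos.mul (h1 x))
    (fun x => (((hlin x).sin.neg.mul_const _).congr_deriv (by ring)).mul (h1 x) |>.add
      ((hlin x).cos.mul (h2 x))) (by fun_prop) ?_ (fun ω hω => (hcos _ _).trans (hK ω hω))
    (fun ω hω => ?_) k).trans ?_
  · simp [hper', Real.sin_int_mul_pi]
  · have t1 := hcos (j * ω) (j ^ 2 * ψ ω)
    have t2 := hsin (j * ω) (2 * j * ψ' ω)
    have t3 := hcos (j * ω) (ψ'' ω)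
    have s1 : |(j : ℝ) ^ 2 * ψ ω| ≤ j ^ 2 * K := by
      rw [abs_mul, abs_sq]
      gcongr
      exact hK ω hω
    have s2 : |2 * j * ψ' ω| ≤ (1 + j ^ 2) * K := by
      rw [abs_mul]
      refine mul_le_mul ?_ (hK' ω hω) (abs_nonneg _) (by positivity)
      rw [abs_le]
      constructor <;> nlinarith [sq_nonneg ((j : ℝ) - 1), sq_nonneg ((j : ℝ) + 1)]
    have s3 := hK'' ω hω
    have e : -(Real.cos (j * ω) * j) * j * ψ ω + -Real.sin (j * ω) * j * ψ' ω +
        (-Real.sin (j * ω) * j * ψ' ω + Real.cos (j * ω) * ψ'' ω) =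
        -(Real.cos (j * ω) * (j ^ 2 * ψ ω)) - Real.sin (j * ω) * (2 * j * ψ' ω) +
          Real.cos (j * ω) * ψ'' ω := by ring
    rw [e, abs_le]
    rw [abs_le] at t1 t2 t3
    constructor <;> linarith
  · have := Real.pi_pos
    gcongr
    nlinarith [mul_nonneg hK0 (sq_nonneg (j : ℝ))]

/-- Expanding both cosine series reduces the form to the matrix entries bounded above, with `ψ =
φ⁻²`. The constant dominates `|ψ|`, `|ψ'|` and `|ψ''|` at once: the respective bounds are `a⁻²`,
`2b/a³` and `6b²/a⁴ + 2b/a³`. -/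
lemma abs_weightedInner_le (hφ : IsWeight φ) {a b : ℝ} (ha : 0 < a)
    (h1 : ∀ ω ∈ Icc (-Real.pi) Real.pi, a ≤ φ ω)
    (h2 : ∀ ω ∈ Icc (-Real.pi) Real.pi, |deriv φ ω| ≤ b)
    (h3 : ∀ ω ∈ Icc (-Real.pi) Real.pi, |deriv (deriv φ) ω| ≤ b)
    (hu : Summable u) (hv : Summable v) (hv2 : Summable fun j : ℤ => |v j| * (1 + (j : ℝ) ^ 2)) :
    |weightedInner φ u v| ≤ 3 * ((a ^ 2)⁻¹ + 2 * b / a ^ 3 + 6 * b ^ 2 / a ^ 4) *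
      (∑' k : ℤ, |u k| / (1 + (k : ℝ) ^ 2)) * ∑' j : ℤ, |v j| * (1 + (j : ℝ) ^ 2) := by
  have hb : 0 ≤ b := (abs_nonneg _).trans (h2 0 (by simp [Real.pi_pos.le]))
  set K := (a ^ 2)⁻¹ + 2 * b / a ^ 3 + 6 * b ^ 2 / a ^ 4 with hK
  have hpi := Real.pi_pos
  have hd2 : ContDiff ℝ 1 (deriv φ) := (contDiff_succ_iff_deriv.1
    (show ContDiff ℝ (1 + 1) φ by simpa [one_add_one_eq_two] using hφ.contDiff)).2.2
  have hφ1 : ∀ x, HasDerivAt φ (deriv φ x) x := fun x =>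
    (hφ.contDiff.differentiable (by norm_num) x).hasDerivAt
  have hφ2 : ∀ x, HasDerivAt (deriv φ) (deriv (deriv φ) x) x := fun x =>
    (hd2.differentiable (by norm_num) x).hasDerivAt
  have hc2 : Continuous (deriv (deriv φ)) := hd2.continuous_deriv le_rfl
  have hc1 : Continuous (deriv φ) := hd2.continuous
  have hc0 : Continuous φ := hφ.contDiff.continuous
  have hne : ∀ x, φ x ≠ 0 := fun x => (hφ.pos x).ne'
  have hsym : ∀ f : ℝ → ℝ, Function.Periodic f (2 * Real.pi) → f Real.pi = f (-Real.pi) := by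
    intro f hf
    rw [← hf (-Real.pi)]
    congr 1
    ring
  have hper : φ Real.pi = φ (-Real.pi) := hsym _ hφ.periodic
  have hper' : deriv φ Real.pi = deriv φ (-Real.pi) := hsym _ fun x => by
    rw [← deriv_comp_add_const]
    congr 1
    exact funext hφ.periodic
  have hψ1 : ∀ x, HasDerivAt (fun x => (φ x ^ 2)⁻¹) (-2 * deriv φ x / φ x ^ 3) x := fun x => by
    refine (((hφ1 x).pow 2).inv (pow_ne_zero 2 (hne x))).congr_deriv ?_
    have := hne x
    simp
    field_simp
  have hψ2 : ∀ x, HasDerivAt (fun x => -2 * deriv φ x / φ x ^ 3)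
      (6 * deriv φ x ^ 2 / φ x ^ 4 - 2 * deriv (deriv φ) x / φ x ^ 3) x := fun x => by
    refine (((hφ2 x).const_mul (-2)).div ((hφ1 x).pow 3) (pow_ne_zero 3 (hne x))).congr_deriv ?_
    have := hne x
    simp only [Pi.pow_apply]
    field_simp
    push_cast
    ring
  have hKb : ∀ ω ∈ Icc (-Real.pi) Real.pi, |(φ ω ^ 2)⁻¹| ≤ K := by
    intro ω hω
    have := h1 ω hω
    have e : (φ ω ^ 2)⁻¹ ≤ (a ^ 2)⁻¹ := by gcongr
    rw [abs_of_nonneg (by positivity)]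
    have : 0 ≤ 2 * b / a ^ 3 := by positivity
    have : 0 ≤ 6 * b ^ 2 / a ^ 4 := by positivity
    linarith
  have hcube : ∀ ω ∈ Icc (-Real.pi) Real.pi, ∀ y, |y| ≤ b → |2 * y / φ ω ^ 3| ≤ 2 * b / a ^ 3 := by
    intro ω hω y hy
    have := h1 ω hω
    rw [abs_div, abs_mul, abs_two, abs_of_pos (pow_pos (hφ.pos ω) 3)]
    gcongr
  have hKb' : ∀ ω ∈ Icc (-Real.pi) Real.pi, |-2 * deriv φ ω / φ ω ^ 3| ≤ K := by
    intro ω hω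
    have := hcube ω hω _ (h2 ω hω)
    rw [neg_mul, neg_div, abs_neg]
    have : 0 ≤ (a ^ 2)⁻¹ := by positivity
    have : 0 ≤ 6 * b ^ 2 / a ^ 4 := by positivity
    linarith
  have hKb'' : ∀ ω ∈ Icc (-Real.pi) Real.pi,
      |6 * deriv φ ω ^ 2 / φ ω ^ 4 - 2 * deriv (deriv φ) ω / φ ω ^ 3| ≤ K := by
    intro ω hω
    have e1 := hcube ω hω _ (h3 ω hω)
    have e2 : |6 * deriv φ ω ^ 2 / φ ω ^ 4| ≤ 6 * b ^ 2 / a ^ 4 := by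
      have := h1 ω hω
      have h := pow_le_pow_left₀ (abs_nonneg _) (h2 ω hω) 2
      rw [sq_abs] at h
      rw [abs_of_nonneg (by positivity)]
      gcongr
    have : 0 ≤ (a ^ 2)⁻¹ := by positivity
    refine (abs_sub _ _).trans ?_
    linarith
  have hcos := abs_integral_cos_mul_cos_mul_le hψ1 hψ2 (by fun_prop (disch := simp [hne]))
    (by simp [hper, hper']) hKb hKb' hKb''
  set D := ∑' j : ℤ, |v j| * (1 + (j : ℝ) ^ 2) with hD
  have hinner : ∀ k : ℤ, |∫ ω in -Real.pi..Real.pi,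
      Real.cos (k * ω) * (cosSeries v ω * (φ ω ^ 2)⁻¹)| ≤
        2 * Real.pi * (3 * K) * D / (1 + (k : ℝ) ^ 2) := by
    intro k
    have hs := hasSum_integral_cosSeries_mul hv
      (h := fun ω => Real.cos (k * ω) * (φ ω ^ 2)⁻¹)
      ((by fun_prop : Continuous _).mul hφ.continuous_inv_sq) (-Real.pi) Real.pi
    have e : ∫ ω in -Real.pi..Real.pi, Real.cos (k * ω) * (cosSeries v ω * (φ ω ^ 2)⁻¹) =
        ∫ ω in -Real.pi..Real.pi, cosSeries v ω * (Real.cos (k * ω) * (φ ω ^ 2)⁻¹) := by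
      congr 1 with ω
      ring
    rw [e, ← hs.tsum_eq, ← Real.norm_eq_abs]
    have hb := (hv2.hasSum.mul_left (2 * Real.pi * (3 * K) / (1 + (k : ℝ) ^ 2)))
    rw [← hD, div_mul_eq_mul_div] at hb
    refine tsum_of_norm_bounded hb fun j => ?_
    have e2 : ∫ ω in -Real.pi..Real.pi, Real.cos (j * ω) * (Real.cos (k * ω) * (φ ω ^ 2)⁻¹) =
        ∫ ω in -Real.pi..Real.pi, Real.cos (k * ω) * (Real.cos (j * ω) * (φ ω ^ 2)⁻¹) := by
      congr 1 with ω
      ring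
    rw [e2, norm_mul, Real.norm_eq_abs, Real.norm_eq_abs]
    refine (mul_le_mul_of_nonneg_left (hcos k j) (abs_nonneg _)).trans_eq ?_
    ring
  have hs := hasSum_integral_cosSeries_mul hu (h := fun ω => cosSeries v ω * (φ ω ^ 2)⁻¹)
    ((continuous_cosSeries hv).mul hφ.continuous_inv_sq) (-Real.pi) Real.pi
  have hu2 : Summable fun k : ℤ => |u k| / (1 + (k : ℝ) ^ 2) :=
    .of_nonneg_of_le (fun k => by positivity)
      (fun k => div_le_self (abs_nonneg _) (by linarith [sq_nonneg (k : ℝ)])) hu.abs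
  have hfin : |∫ ω in -Real.pi..Real.pi, cosSeries u ω * (cosSeries v ω * (φ ω ^ 2)⁻¹)| ≤
      2 * Real.pi * (3 * K) * D * ∑' k : ℤ, |u k| / (1 + (k : ℝ) ^ 2) := by
    rw [← hs.tsum_eq, ← Real.norm_eq_abs]
    refine tsum_of_norm_bounded (hu2.hasSum.mul_left _) fun k => ?_
    rw [norm_mul, Real.norm_eq_abs, Real.norm_eq_abs]
    refine (mul_le_mul_of_nonneg_left (hinner k) (abs_nonneg _)).trans_eq ?_
    ring
  rw [weightedInner, abs_mul, abs_of_pos (by positivity)]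
  refine (mul_le_mul_of_nonneg_left hfin (by positivity)).trans_eq ?_
  field_simp

end WeightedInner

lemma summable_int_of_natAbs {f : ℕ → ℝ} (hf : Summable f) :
    Summable fun k : ℤ => f k.natAbs :=
  Summable.of_nat_of_neg (by simpa using hf) (by simpa using hf)

lemma summable_pow_natAbs_mul {ρ : ℝ} (h0 : 0 ≤ ρ) (h1 : ρ < 1) :
    Summable fun k : ℤ => ρ ^ k.natAbs * (1 + (k : ℝ) ^ 2) := by
  have h := (summable_geometric_of_lt_one h0 h1).add
    (summable_pow_mul_geometric_of_norm_lt_one 2 (r := ρ) (by rwa [Real.norm_of_nonneg h0]))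
  refine (summable_int_of_natAbs h).congr fun k => ?_
  rw [Nat.cast_natAbs]
  push_cast
  rw [sq_abs]
  ring

lemma summable_inv_one_add_sq : Summable fun k : ℤ => (1 + (k : ℝ) ^ 2)⁻¹ := by
  refine Summable.of_norm_bounded_eventually
    (Real.summable_one_div_int_pow (p := 2).2 one_lt_two) ?_
  filter_upwards [(finite_singleton (0 : ℤ)).compl_mem_cofinite] with k hk
  have : (k : ℝ) ≠ 0 := by simpa using hk
  rw [norm_inv, Real.norm_of_nonneg (by positivity), one_div]
  gcongr
  linarith

/-! ### The estimator: existence, uniqueness and consistency. -/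

section Estimator

variable {C : Set ℝ} {ρ : ℝ}

lemma summable_abs_mul_of_mem_momentSpace (h0 : 0 ≤ ρ) (h1 : ρ < 1) (hCρ : ∀ x ∈ C, |x| ≤ ρ)
    {m : ℤ → ℝ} (hm : m ∈ momentSpace C) : Summable fun k : ℤ => |m k| * (1 + (k : ℝ) ^ 2) := by
  refine .of_nonneg_of_le (fun k => by positivity) (fun k => ?_)
    ((summable_pow_natAbs_mul h0 h1).mul_left (m 0))
  rw [← mul_assoc]
  gcongr
  exact abs_le_of_mem_momentSpace hCρ hm k

lemma momentSpace_subset_evenSummable (h0 : 0 ≤ ρ) (h1 : ρ < 1) (hCρ : ∀ x ∈ C, |x| ≤ ρ)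
    {m : ℤ → ℝ} (hm : m ∈ momentSpace C) : m ∈ evenSummable := by
  refine ⟨even_of_mem_momentSpace hm, .of_norm_bounded
    (summable_abs_mul_of_mem_momentSpace h0 h1 hCρ hm) fun k => ?_⟩
  exact le_mul_of_one_le_right (abs_nonneg _) (by linarith [sq_nonneg (k : ℝ)])

lemma isSquareSummable_of_summable {m : ℤ → ℝ} (hm : Summable m) : IsSquareSummable m := by
  unfold IsSquareSummable
  have h := hm.norm.tendsto_cofinite_zero.eventually_lt_const one_pos
  refine Summable.of_norm_bounded_eventually hm.norm ?_
  filter_upwards [h] with k hk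
  rw [norm_pow, sq]
  exact mul_le_of_le_one_left (norm_nonneg _) hk.le

lemma isWeightedMomentLSE_iff (h0 : 0 ≤ ρ) (h1 : ρ < 1) (hCρ : ∀ x ∈ C, |x| ≤ ρ) {φ : ℝ → ℝ}
    {r : ℤ → ℝ} (hr : r ∈ evenSummable) {f : ℤ → ℝ} :
    IsWeightedMomentLSE φ r C f ↔ f ∈ momentSpace C ∧ ∀ h ∈ momentSpace C,
      weightedInner φ (r - f) (r - f) ≤ weightedInner φ (r - h) (r - h) := by
  have hsub : ∀ {m}, m ∈ momentSpace C → m ∈ evenSummable :=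
    momentSpace_subset_evenSummable h0 h1 hCρ
  have hq : ∀ {m}, m ∈ momentSpace C →
      weightedNormSq φ (r - m) = weightedInner φ (r - m) (r - m) := fun hm =>
    weightedNormSq_eq_weightedInner (sub_mem hr (hsub hm))
  constructor
  · intro hf
    refine ⟨hf.mem, fun h hh => ?_⟩
    rw [← hq hf.mem, ← hq hh]
    exact hf.le h hh (isSquareSummable_of_summable (hsub hh).2)
  · rintro ⟨hf, hle⟩
    refine ⟨hf, isSquareSummable_of_summable (hsub hf).2, fun h hh _ => ?_⟩
    rw [hq hf, hq hh]
    exact hle h hh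

/-- The first order optimality condition. -/
lemma weightedInner_sub_sub_nonpos (hC : IsCompact C) (hC1 : C ⊆ Icc (-1) 1) (h0 : 0 ≤ ρ)
    (h1 : ρ < 1) (hCρ : ∀ x ∈ C, |x| ≤ ρ) {φ : ℝ → ℝ} (hφ : IsWeight φ) {r : ℤ → ℝ}
    (hr : r ∈ evenSummable) {f h : ℤ → ℝ} (hf : f ∈ momentSpace C) (hh : h ∈ momentSpace C)
    (hle : ∀ h ∈ momentSpace C,
      weightedInner φ (r - f) (r - f) ≤ weightedInner φ (r - h) (r - h)) :
    weightedInner φ (r - f) (h - f) ≤ 0 := by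
  have hf' := momentSpace_subset_evenSummable h0 h1 hCρ hf
  have hh' := momentSpace_subset_evenSummable h0 h1 hCρ hh
  -- Compare `f` with `(1 - t) f + t h`, which stays in the cone by convexity, divide by `t` and let
  -- `t → 0`.
  have key : ∀ t : ℝ, 0 < t → t ≤ 1 →
      2 * weightedInner φ (r - f) (h - f) ≤ t * weightedInner φ (h - f) (h - f) := by
    intro t ht ht1
    have hmem := convex_momentSpace hC hC1 hf hh (sub_nonneg.2 ht1) ht.le (by ring)
    have := hle _ hmem
    have e : r - ((1 - t) • f + t • h) = (r - f) + (-t) • (h - f) := by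
      ext k
      simp only [Pi.sub_apply, Pi.add_apply, Pi.smul_apply, smul_eq_mul]
      ring
    rw [e, weightedInner_self_add_smul hφ (sub_mem hr hf').2 (sub_mem hh' hf').2] at this
    have h2 : t * (2 * weightedInner φ (r - f) (h - f)) ≤
        t * (t * weightedInner φ (h - f) (h - f)) := by linarith
    exact le_of_mul_le_mul_left h2 ht
  have hlim : Tendsto (fun t : ℝ => t * weightedInner φ (h - f) (h - f)) (𝓝[>] 0) (𝓝 0) := by
    have : Tendsto (fun t : ℝ => t * weightedInner φ (h - f) (h - f)) (𝓝 0)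
        (𝓝 (0 * weightedInner φ (h - f) (h - f))) := (continuous_mul_const _).tendsto 0
    rw [zero_mul] at this
    exact this.mono_left nhdsWithin_le_nhds
  have := ge_of_tendsto hlim (b := 2 * weightedInner φ (r - f) (h - f)) (by
    filter_upwards [Ioc_mem_nhdsGT (zero_lt_one (α := ℝ))] with t ht
    exact key t ht.1 ht.2)
  linarith

/-- A bound on the mass bounds every coordinate, so Tychonoff's theorem applies to this closed set.
-/
lemma isCompact_momentSpace_inter (hC : IsCompact C) (hC1 : C ⊆ Icc (-1) 1) (B : ℝ) :
    IsCompact (momentSpace C ∩ {m | m 0 ≤ B}) := by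
  have hsub : momentSpace C ∩ {m | m 0 ≤ B} ⊆ Set.pi univ fun _ : ℤ => Icc (-B) B := by
    rintro m ⟨hm, hB⟩ k -
    have := abs_le_of_mem_momentSpace (ρ := 1) (fun x hx => abs_le.2 (hC1 hx)) hm k
    rw [one_pow, mul_one] at this
    exact abs_le.1 (this.trans hB)
  exact (isCompact_univ_pi fun _ => isCompact_Icc).of_isClosed_subset
    ((isClosed_momentSpace hC hC1).inter (isClosed_le (continuous_apply 0) continuous_const)) hsub

/-- Coordinatewise convergence suffices because bounded mass gives the common summable majorant `|r
k| + B ρ^|k|`. -/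
lemma continuousOn_weightedInner_sub (h0 : 0 ≤ ρ) (h1 : ρ < 1) (hCρ : ∀ x ∈ C, |x| ≤ ρ)
    {φ : ℝ → ℝ} (hφ : IsWeight φ) {r : ℤ → ℝ} (hr : Summable r) (B : ℝ) :
    ContinuousOn (fun h => weightedInner φ (r - h) (r - h))
      (momentSpace C ∩ {m | m 0 ≤ B}) := by
  have hpow : Summable fun k : ℤ => ρ ^ k.natAbs :=
    summable_int_of_natAbs (summable_geometric_of_lt_one h0 h1)
  have hbound : ∀ h ∈ momentSpace C ∩ {m | m 0 ≤ B}, ∀ (k : ℤ) (ω : ℝ),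
      ‖(r - h) k * Real.cos (k * ω)‖ ≤ |r k| + B * ρ ^ k.natAbs := by
    rintro h ⟨hh, hB⟩ k ω
    refine (norm_mul_cos_le _ _).trans ((norm_sub_le _ _).trans ?_)
    exact add_le_add le_rfl ((abs_le_of_mem_momentSpace hCρ hh k).trans
      (mul_le_mul_of_nonneg_right hB (by positivity)))
  have hsum : Summable fun k : ℤ => |r k| + B * ρ ^ k.natAbs := hr.abs.add (hpow.mul_left B)
  have hle : ∀ h ∈ momentSpace C ∩ {m | m 0 ≤ B}, ∀ ω,
      ‖cosSeries (r - h) ω‖ ≤ ∑' k : ℤ, (|r k| + B * ρ ^ k.natAbs) := fun h hh ω =>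
    tsum_of_norm_bounded hsum.hasSum fun k => hbound h hh k ω
  have hcont : ∀ ω, ContinuousOn (fun h => cosSeries (r - h) ω)
      (momentSpace C ∩ {m | m 0 ≤ B}) := fun ω =>
    continuousOn_tsum (fun k => Continuous.continuousOn (by fun_prop)) hsum
      fun k h hh => hbound h hh k ω
  unfold weightedInner
  refine ContinuousOn.const_mul ?_ _
  intro h hh
  set S := ∑' k : ℤ, (|r k| + B * ρ ^ k.natAbs)
  refine intervalIntegral.continuousWithinAt_of_dominated_interval
    (bound := fun ω => S * (S * (φ ω ^ 2)⁻¹)) ?_ ?_ ?_ ?_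
  · filter_upwards [self_mem_nhdsWithin] with h hh
    have hs := continuous_cosSeries
      (hr.sub (momentSpace_subset_evenSummable h0 h1 hCρ hh.1).2)
    exact (hs.mul (hs.mul hφ.continuous_inv_sq)).aestronglyMeasurable
  · filter_upwards [self_mem_nhdsWithin] with h hh
    refine ae_of_all _ fun ω _ => ?_
    have hS := hle h hh ω
    have hψ : 0 ≤ (φ ω ^ 2)⁻¹ := by positivity
    have hS0 : 0 ≤ S := (norm_nonneg _).trans hS
    rw [norm_mul, norm_mul, Real.norm_of_nonneg hψ]
    gcongr
  · have := hφ.continuous_inv_sq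
    exact (by fun_prop : Continuous _).intervalIntegrable _ _
  · exact ae_of_all _ fun ω _ =>
      (hcont ω h hh).mul ((hcont ω h hh).mul continuousWithinAt_const)

/-- Existence and uniqueness of the weighted moment least squares estimator. -/
theorem existsUnique_isWeightedMomentLSE (hC : IsCompact C) (hC1 : C ⊆ Icc (-1) 1) (h0 : 0 ≤ ρ)
    (h1 : ρ < 1) (hCρ : ∀ x ∈ C, |x| ≤ ρ) {φ : ℝ → ℝ} (hφ : IsWeight φ) {r : ℤ → ℝ}
    (hr : r ∈ evenSummable) : ∃! f, IsWeightedMomentLSE φ r C f := by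
  have hsub : ∀ {m}, m ∈ momentSpace C → m ∈ evenSummable :=
    momentSpace_subset_evenSummable h0 h1 hCρ
  obtain ⟨c₀, c, -, hc⟩ := hφ.bounded
  have hc' : ∀ ω ∈ Icc (-Real.pi) Real.pi, φ ω ≤ c := fun ω _ => (hc ω).2
  set R := weightedInner φ (r - 0) (r - 0) with hR
  -- Any competitor at least as good as the zero sequence has mass at most `B`; the worse ones are
  -- beaten by zero itself, which lies in the compact slice.
  set B := |r 0| + √(c ^ 2 * R) with hB
  obtain ⟨f, hf, hmin⟩ := (isCompact_momentSpace_inter hC hC1 B).exists_isMinOn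
    ⟨0, zero_mem_momentSpace C, by simp only [mem_ofPred_eq, Pi.zero_apply]; positivity⟩
    (continuousOn_weightedInner_sub h0 h1 hCρ hφ hr.2 B)
  have hle : ∀ h ∈ momentSpace C,
      weightedInner φ (r - f) (r - f) ≤ weightedInner φ (r - h) (r - h) := by
    intro h hh
    by_cases hhR : weightedInner φ (r - h) (r - h) ≤ R
    · refine hmin ⟨hh, ?_⟩
      have h2 := sq_apply_le hφ hc' (sub_mem hr (hsub hh)) 0
      have h3 : |(r - h) 0| ≤ √(c ^ 2 * R) :=
        Real.abs_le_sqrt (h2.trans (mul_le_mul_of_nonneg_left hhR (sq_nonneg c)))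
      have h4 := (abs_le.1 h3).1
      have h5 := le_abs_self (r 0)
      simp only [Pi.sub_apply] at h4
      simp only [mem_ofPred_eq]
      linarith
    · refine le_trans (hmin ⟨zero_mem_momentSpace C, ?_⟩) (not_le.1 hhR).le
      simp only [mem_ofPred_eq, Pi.zero_apply]
      positivity
  refine ⟨f, (isWeightedMomentLSE_iff h0 h1 hCρ hr).2 ⟨hf.1, hle⟩, fun f' hf' => ?_⟩
  obtain ⟨hf'm, hle'⟩ := (isWeightedMomentLSE_iff h0 h1 hCρ hr).1 hf'
  -- The optimality conditions of two minimizers, each tested against the other, add up to `‖f' -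
  -- f‖² ≤ 0`.
  have i1 := weightedInner_sub_sub_nonpos hC hC1 h0 h1 hCρ hφ hr hf.1 hf'm hle
  have i2 := weightedInner_sub_sub_nonpos hC hC1 h0 h1 hCρ hφ hr hf'm hf.1 hle'
  have e1 := weightedInner_sub_self hφ hr.2 (hsub hf'm).2 (hsub hf.1).2
  have i3 : weightedInner φ (f' - f) (f' - f) ≤ 0 := by linarith
  funext k
  have h2 := sq_apply_le hφ hc' (sub_mem (hsub hf'm) (hsub hf.1)) k
  have h3 : (f' - f) k ^ 2 ≤ 0 := h2.trans (mul_nonpos_of_nonneg_of_nonpos (sq_nonneg c) i3)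
  exact sub_eq_zero.1 (pow_eq_zero_iff two_ne_zero |>.1 (le_antisymm h3 (sq_nonneg _)))

/-- The deviation of the estimator is controlled by a weak norm of the error of the input. -/
lemma sq_estimator_sub_le (hC : IsCompact C) (hC1 : C ⊆ Icc (-1) 1) (h0 : 0 ≤ ρ)
    (h1 : ρ < 1) (hCρ : ∀ x ∈ C, |x| ≤ ρ) {φ : ℝ → ℝ} (hφ : IsWeight φ) {a b : ℝ} (ha : 0 < a)
    (hb : 0 ≤ b) (hφa : ∀ ω ∈ Icc (-Real.pi) Real.pi, a ≤ φ ω)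
    (hφb : ∀ ω ∈ Icc (-Real.pi) Real.pi, φ ω ≤ b)
    (hφ' : ∀ ω ∈ Icc (-Real.pi) Real.pi, |deriv φ ω| ≤ b)
    (hφ'' : ∀ ω ∈ Icc (-Real.pi) Real.pi, |deriv (deriv φ) ω| ≤ b) {r f γ : ℤ → ℝ}
    (hr : r ∈ evenSummable) (hγ : γ ∈ momentSpace C) (hf : IsWeightedMomentLSE φ r C f) (k : ℤ) :
    (f k - γ k) ^ 2 ≤ b ^ 2 * (3 * ((a ^ 2)⁻¹ + 2 * b / a ^ 3 + 6 * b ^ 2 / a ^ 4)) *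
      (∑' j : ℤ, ρ ^ j.natAbs * (1 + (j : ℝ) ^ 2)) *
      (∑' j : ℤ, |r j - γ j| / (1 + (j : ℝ) ^ 2)) * (f 0 + γ 0) := by
  obtain ⟨hfm, hle⟩ := (isWeightedMomentLSE_iff h0 h1 hCρ hr).1 hf
  have hf' := momentSpace_subset_evenSummable h0 h1 hCρ hfm
  have hγ' := momentSpace_subset_evenSummable h0 h1 hCρ hγ
  -- Testing optimality against `γ` gives `‖f - γ‖² ≤ ⟨r - γ, f - γ⟩`, to which the weak-strong
  -- bound applies.
  have i1 := weightedInner_sub_sub_nonpos hC hC1 h0 h1 hCρ hφ hr hfm hγ hle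
  have e1 := weightedInner_sub_self hφ hr.2 hf'.2 hγ'.2
  have hpt : ∀ j : ℤ, |(f - γ) j| * (1 + (j : ℝ) ^ 2) ≤
      (f 0 + γ 0) * (ρ ^ j.natAbs * (1 + (j : ℝ) ^ 2)) := by
    intro j
    rw [← mul_assoc]
    gcongr
    refine (abs_sub _ _).trans ?_
    rw [add_mul]
    exact add_le_add (abs_le_of_mem_momentSpace hCρ hfm j) (abs_le_of_mem_momentSpace hCρ hγ j)
  have hD := (summable_pow_natAbs_mul h0 h1).mul_left (f 0 + γ 0)
  have hv2 : Summable fun j : ℤ => |(f - γ) j| * (1 + (j : ℝ) ^ 2) :=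
    .of_nonneg_of_le (fun j => by positivity) hpt hD
  have hv3 : ∑' j : ℤ, |(f - γ) j| * (1 + (j : ℝ) ^ 2) ≤
      (f 0 + γ 0) * ∑' j : ℤ, ρ ^ j.natAbs * (1 + (j : ℝ) ^ 2) := by
    rw [← tsum_mul_left]
    exact hv2.tsum_le_tsum hpt hD
  have i2 := abs_weightedInner_le hφ ha hφa hφ' hφ'' (sub_mem hr hγ').2 (sub_mem hf' hγ').2 hv2
  have i3 := sq_apply_le hφ hφb (sub_mem hf' hγ') k
  have hS : 0 ≤ ∑' j : ℤ, |(r - γ) j| / (1 + (j : ℝ) ^ 2) := tsum_nonneg fun j => by positivity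
  have i4 : weightedInner φ (f - γ) (f - γ) ≤
      3 * ((a ^ 2)⁻¹ + 2 * b / a ^ 3 + 6 * b ^ 2 / a ^ 4) *
        (∑' j : ℤ, |(r - γ) j| / (1 + (j : ℝ) ^ 2)) *
          ((f 0 + γ 0) * ∑' j : ℤ, ρ ^ j.natAbs * (1 + (j : ℝ) ^ 2)) := by
    have i5 := le_abs_self (weightedInner φ (r - γ) (f - γ))
    calc weightedInner φ (f - γ) (f - γ) ≤ |weightedInner φ (r - γ) (f - γ)| := by linarith
      _ ≤ _ := i2
      _ ≤ _ := by gcongr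
  refine i3.trans ((mul_le_mul_of_nonneg_left i4 (sq_nonneg b)).trans_eq ?_)
  simp only [Pi.sub_apply]
  ring

/-- Consistency of the weighted moment least squares estimators. -/
theorem tendsto_estimator (hC : IsCompact C) (hC1 : C ⊆ Icc (-1) 1) (h0 : 0 ≤ ρ)
    (h1 : ρ < 1) (hCρ : ∀ x ∈ C, |x| ≤ ρ) {φ : ℕ → ℝ → ℝ} (hφ : ∀ M, IsWeight (φ M)) {a b : ℝ}
    (ha : 0 < a) (hb : 0 ≤ b) (hφa : ∀ᶠ M in atTop, ∀ ω ∈ Icc (-Real.pi) Real.pi, a ≤ φ M ω)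
    (hφb : ∀ᶠ M in atTop, ∀ ω ∈ Icc (-Real.pi) Real.pi,
      φ M ω ≤ b ∧ |deriv (φ M) ω| ≤ b ∧ |deriv (deriv (φ M)) ω| ≤ b)
    {r f : ℕ → ℤ → ℝ} {γ : ℤ → ℝ} (hr : ∀ M, r M ∈ evenSummable) (hpeak : ∀ M k, |r M k| ≤ r M 0)
    (hrγ : ∀ k, Tendsto (fun M => r M k) atTop (𝓝 (γ k))) (hγ : γ ∈ momentSpace C)
    (hf : ∀ M, IsWeightedMomentLSE (φ M) (r M) C (f M)) (k : ℤ) :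
    Tendsto (fun M => f M k) atTop (𝓝 (γ k)) := by
  have hγ0 := apply_zero_nonneg_of_mem_momentSpace hγ
  have hS : Tendsto (fun M => ∑' j : ℤ, |r M j - γ j| / (1 + (j : ℝ) ^ 2)) atTop (𝓝 0) := by
    have h := tendsto_tsum_of_dominated_convergence (𝓕 := atTop)
      (f := fun M (j : ℤ) => |r M j - γ j| / (1 + (j : ℝ) ^ 2)) (g := fun _ => (0 : ℝ))
      -- Eventually `|r M j| ≤ r M 0 < γ 0 + 1`, while `|γ j| ≤ γ 0`.
      (summable_inv_one_add_sq.mul_left (2 * γ 0 + 1)) ?_ ?_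
    · simpa using h
    · intro j
      simpa using ((hrγ j).sub_const (γ j)).abs.div_const (1 + (j : ℝ) ^ 2)
    · filter_upwards [(hrγ 0).eventually_lt_const (lt_add_one _)] with M hM j
      rw [Real.norm_of_nonneg (by positivity), div_eq_mul_inv]
      have hj := abs_le_of_mem_momentSpace (ρ := 1) (fun x hx => abs_le.2 (hC1 hx)) hγ j
      rw [one_pow, mul_one] at hj
      have := abs_sub (r M j) (γ j)
      have := hpeak M j
      gcongr
      linarith
  set κ := b ^ 2 * (3 * ((a ^ 2)⁻¹ + 2 * b / a ^ 3 + 6 * b ^ 2 / a ^ 4)) *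
    (∑' j : ℤ, ρ ^ j.natAbs * (1 + (j : ℝ) ^ 2)) with hκ
  have hε := hS.const_mul κ
  rw [mul_zero] at hε
  have hε0 : ∀ M, 0 ≤ κ * ∑' j : ℤ, |r M j - γ j| / (1 + (j : ℝ) ^ 2) := fun M =>
    mul_nonneg (mul_nonneg (by positivity) (tsum_nonneg fun j => by positivity))
      (tsum_nonneg fun j => by positivity)
  have hsq : ∀ᶠ M in atTop, (f M k - γ k) ^ 2 ≤
      (κ * ∑' j : ℤ, |r M j - γ j| / (1 + (j : ℝ) ^ 2)) * (4 * γ 0 + 1) := by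
    filter_upwards [hφa, hφb, hε.eventually_lt_const one_pos] with M h2 h3 h4
    have hk := fun k => sq_estimator_sub_le hC hC1 h0 h1 hCρ (hφ M) ha hb h2
      (fun ω hω => (h3 ω hω).1) (fun ω hω => (h3 ω hω).2.1) (fun ω hω => (h3 ω hω).2.2) (hr M) hγ (hf M) k
    rw [← hκ] at hk
    have hf0 := apply_zero_nonneg_of_mem_momentSpace (hf M).mem
    -- The bound is quadratic in `f M 0` on the left and linear on the right, so it confines `f M
    -- 0`; reinserting this makes the bound on every coordinate vanish in the limit.
    have hd : (f M 0 - γ 0) ^ 2 ≤ f M 0 + γ 0 :=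
      (hk 0).trans (mul_le_of_le_one_left (by positivity) h4.le)
    have hd' : f M 0 ≤ 3 * γ 0 + 1 := by
      by_contra! hlt
      nlinarith
    exact (hk k).trans (mul_le_mul_of_nonneg_left (by linarith) (hε0 M))
  have hsq0 : Tendsto (fun M => (f M k - γ k) ^ 2) atTop (𝓝 0) :=
    squeeze_zero' (Eventually.of_forall fun M => sq_nonneg _) hsq (by
      simpa using hε.mul_const (4 * γ 0 + 1))
  have habs : Tendsto (fun M => |f M k - γ k|) atTop (𝓝 0) := by
    have := (Real.continuous_sqrt.tendsto 0).comp hsq0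
    simpa [Function.comp_def, Real.sqrt_sq_eq_abs] using this
  exact tendsto_sub_nhds_zero_iff.1 ((tendsto_zero_iff_abs_tendsto_zero _).2 habs)

end Estimator

/-! ### From the hypotheses on the path to the deterministic statements. -/

lemma IsInitialEstimator.mem_evenSummable {X : Type*} [MeasurableSpace X] {Q : Kernel X X}
    [IsMarkovKernel Q] {γ : ℤ → ℝ} {r : ℕ → (ℕ → X) → ℤ → ℝ} (hr : IsInitialEstimator Q γ r)
    (M : ℕ) (p : ℕ → X) : r M p ∈ evenSummable := by
  refine ⟨hr.even M p, ?_⟩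
  obtain ⟨n, hn⟩ := hr.finite_support M p
  refine summable_of_ne_finset_zero (s := Finset.Ioo (-(n : ℤ)) n) fun k hk => ?_
  rw [Finset.mem_Ioo, not_and_or, not_lt, not_lt] at hk
  rcases hk with hk | hk
  · rw [← hr.even]
    exact hn _ (by omega)
  · exact hn k hk

lemma abs_le_of_supNorm_le {f : ℝ → ℝ} {b : ℝ≥0} (h : supNorm f ≤ b) (ω : ℝ) : |f ω| ≤ b := by
  have h1 : ‖f ω‖ₑ ≤ b := (le_iSup (fun ω => ‖f ω‖ₑ) ω).trans h
  rw [enorm_le_coe] at h1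
  exact_mod_cast h1

lemma HasAsymptoticBounds.eventually {X : Type*} [MeasurableSpace X] {Q : Kernel X X}
    [IsMarkovKernel Q] {φ : ℕ → (ℕ → X) → ℝ → ℝ} (h : HasAsymptoticBounds Q φ) :
    ∃ a b : ℝ, 0 < a ∧ 0 ≤ b ∧ ∀ x : X, ∀ᵐ p ∂(chainLawFrom Q x),
      (∀ᶠ M in atTop, ∀ ω ∈ Icc (-Real.pi) Real.pi, a ≤ φ M p ω) ∧
      ∀ᶠ M in atTop, ∀ ω ∈ Icc (-Real.pi) Real.pi,
        φ M p ω ≤ b ∧ |deriv (φ M p) ω| ≤ b ∧ |deriv (deriv (φ M p)) ω| ≤ b := by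
  obtain ⟨c, c', hc, -, h⟩ := h
  -- Slack on both sides: only bounds strictly beyond the liminf and the limsup hold eventually.
  refine ⟨(c / 2 : ℝ≥0), (c' + 1 : ℝ≥0), by positivity, by positivity, fun x => ?_⟩
  filter_upwards [h x] with p hp
  constructor
  · have hlt : ((c / 2 : ℝ≥0) : ℝ≥0∞) < c := by
      exact_mod_cast NNReal.half_lt_self hc.ne'
    filter_upwards [eventually_lt_of_lt_liminf (hlt.trans_le hp.1)] with M hM ω hω
    have h1 : ((c / 2 : ℝ≥0) : ℝ≥0∞) ≤ ENNReal.ofReal (φ M p ω) := hM.le.trans (iInf₂_le ω hω)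
    rw [← ENNReal.ofReal_coe_nnreal] at h1
    by_contra! hlt'
    have h2 : (0 : ℝ) < (c / 2 : ℝ≥0) := by positivity
    exact absurd h1 (not_le.2 ((ENNReal.ofReal_lt_ofReal_iff h2).2 hlt'))
  · have hlt : (c' : ℝ≥0∞) < ((c' + 1 : ℝ≥0) : ℝ≥0∞) := by
      exact_mod_cast lt_add_one c'
    filter_upwards [eventually_lt_of_limsup_lt (hp.2.trans_lt hlt)] with M hM ω _
    rw [max_lt_iff, max_lt_iff] at hM
    exact ⟨(le_abs_self _).trans (abs_le_of_supNorm_le hM.1.le ω),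
      abs_le_of_supNorm_le hM.2.1.le ω, abs_le_of_supNorm_le hM.2.2.le ω⟩

end MomentLSE

theorem corollary2 {X : Type*} [MeasurableSpace X]
    (Q : Kernel X X) [IsMarkovKernel Q] (π : Measure X) [IsProbabilityMeasure π]
    (hharris : MomentLSE.IsHarrisErgodic Q)
    (hrev : Q.IsReversible π)
    (hgeom : MomentLSE.IsGeometricallyErgodic Q π)
    (g : X → ℝ) (hg : Measurable g) (hg2 : MemLp g 2 π)
    (δ : ℝ) (hδ : 0 < δ)
    (hsupp : ∀ μ : Measure ℝ,
      MomentLSE.IsRepresentingMeasure μ (MomentLSE.autocov Q π g) →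
        μ.support ⊆ Icc (-1 + δ) (1 - δ))
    (r : ℕ → (ℕ → X) → ℤ → ℝ)
    (hr : MomentLSE.IsInitialEstimator Q (MomentLSE.autocov Q π g) r)
    (φ : ℕ → (ℕ → X) → ℝ → ℝ)
    (hφ : ∀ M p, MomentLSE.IsWeight (φ M p))
    (hφ' : MomentLSE.HasAsymptoticBounds Q φ) :
    ∃ (μγ : Measure ℝ) (f : ℕ → (ℕ → X) → ℤ → ℝ) (μhat : ℕ → (ℕ → X) → Measure ℝ),
      (∀ μ, MomentLSE.IsRepresentingMeasure μ (MomentLSE.autocov Q π g) ↔ μ = μγ) ∧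
      (∀ M p h,
        MomentLSE.IsWeightedMomentLSE (φ M p) (r M p) (Icc (-1 + δ) (1 - δ)) h ↔ h = f M p) ∧
      (∀ M p μ, MomentLSE.IsRepresentingMeasure μ (f M p) ↔ μ = μhat M p) ∧
      ∀ x : X, ∀ᵐ p ∂(MomentLSE.chainLawFrom Q x),
        MomentLSE.VaguelyTendsto (fun M => μhat M p) μγ := by
  have hC : IsCompact (Icc (-1 + δ) (1 - δ)) := isCompact_Icc
  have hC1 : Icc (-1 + δ) (1 - δ) ⊆ Icc (-1) 1 := Icc_subset_Icc (by linarith) (by linarith)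
  -- The decay rate is `1 - δ`, truncated at `0` because `δ > 1` is allowed; the interval is then
  -- empty.
  have h0 : 0 ≤ max (1 - δ) 0 := le_max_right _ _
  have h1 : max (1 - δ) 0 < 1 := max_lt (by linarith) one_pos
  have hCρ : ∀ x ∈ Icc (-1 + δ) (1 - δ), |x| ≤ max (1 - δ) 0 := fun x hx =>
    (abs_le.2 ⟨by linarith [hx.1], hx.2⟩).trans (le_max_left _ _)
  obtain ⟨μγ, hμγ⟩ := MomentLSE.exists_representingMeasure_autocov hrev hg2
  choose f hf huniq using fun M p => MomentLSE.existsUnique_isWeightedMomentLSE hC hC1 h0 h1 hCρ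
    (hφ M p) (hr.mem_evenSummable M p)
  choose μhat hμhat _ using fun M p => (hf M p).mem
  refine ⟨μγ, f, μhat, fun μ => ⟨fun h => h.unique hμγ, fun h => h ▸ hμγ⟩,
    fun M p h => ⟨huniq M p h, fun e => e ▸ hf M p⟩,
    fun M p μ => ⟨fun h => h.unique (hμhat M p), fun h => h ▸ hμhat M p⟩, fun x => ?_⟩
  obtain ⟨a, b, ha, hb, hbounds⟩ := hφ'.eventually
  filter_upwards [hbounds x, ae_all_iff.2 (hr.tendsto x)] with p hp hrp h hcont _
  exact MomentLSE.IsRepresentingMeasure.tendsto_integral (fun M => hμhat M p) hμγ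
    (MomentLSE.tendsto_estimator hC hC1 h0 h1 hCρ (fun M => hφ M p) ha hb hp.1 hp.2
      (fun M => hr.mem_evenSummable M p) (fun M => hr.peak M p) hrp ⟨μγ, hμγ, hsupp _ hμγ⟩
      (fun M => hf M p)) hcont
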